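/- Let $k$ be an algebraically closed field and let $A$ be a Hopf $k$-algebra with coproduct $\Delta(a)=\sum a_1\otimes a_2$, antipode $S$ and center $Z(A)$. For an algebra homomorphism $\pi:A\to k$ let $\Xi^l_\pi(a)=\sum\pi(a_1)a_2$ and $\Xi^r_\pi(a)=\sum a_1\pi(a_2)$ be the left and right winding automorphisms of $A$. Let $G^l_\pi=\langle\Xi^l_\pi\rangle$, $G^r_\pi=\langle\Xi^r_\pi\rangle$ and $G_\pi=\langle G^l_\pi,G^r_\pi\rangle$ in $\mathrm{Aut}_{k\text{-alg}}(A)$, and let $A^l_0,A^r_0,A_0$ be the subalgebras of invariants of $G^l_\pi,G^r_\pi,G_\pi$ respectively. The PI-degree of a ring $R$ is the least $m$ such that $R$ embeds in $M_m(C)$ for some commutative ring $C$. Assume: (a) $A$ is finitely generated as an algebra, (left and right) noetherian, prime, and satisfies a polynomial identity; (b) the order $n$ of $\pi$ in the group of algebra homomorphisms $A\to k$ under convolution equals the PI-degree of $A$; (c) $A^l_0$ is a commutative Dedekind domain; (d) if $p=\operatorname{char}k>0$, then $n$ is coprime to $p$. For a character $\chi:G^l_\pi\to k^\times$ put $A^l_\chi=\{a\in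 A: g(a)=\chi(g)a\ \ \forall g\in G^l_\pi\}$. Then there is a unique $k$-algebra automorphism $\kappa^l_\chi$ of $A^l_0$ such that $xa=\kappa^l_\chi(a)x$ for all $x\in A^l_\chi$, $a\in A^l_0$; the analogous statement holds for $\kappa^r_\chi$ on $A^r_0$, $\chi$ a character of $G^r_\pi$. Let $K^l_\pi$ and $K^r_\pi$ be the sets of all $\kappa^l_\chi$ and of all $\kappa^r_\chi$ respectively. Since $G^l_\pi$ and $G^r_\pi$ commute, restriction gives homomorphisms $\rho^l:G^r_\pi\to\mathrm{Aut}(A^l_0)$ and $\rho^r:G^l_\pi\to\mathrm{Aut}(A^r_0)$. Put $P^l_\pi=\langle\rho^l(G^r_\pi),K^l_\pi\rangle$ and $P^r_\pi=\langle\rho^r(G^l_\pi),K^r_\pi\rangle$. Then: (i) $Z(A)\subseteq A_0$. (ii) $P^l_\pi$ is abelian, and $P^l_\pi=K^l_\pi$. (iii) The following are equivalent: (1) $G^l_\pi\cap G^r_\pi=\{1\}$; (2) $|G_\pi|=n^2$; (3) $\rho^l(G^r_\pi)=K^l_\pi=P^l_\pi$; (4) $Z(A)=A_0$; (5) $\rho^r(G^l_\pi)=K^r_\pi=P^r_\pi$.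 (iv) If $G^l_\pi\cap G^r_\pi=\{1\}$, then $A_0=\{a\in A:\Delta(a)\in A_0\otimes A_0\}$, and $A_0=Z(A)$ is a Hopf subalgebra of $A$, that is, $\Delta(A_0)\subseteq A_0\otimes A_0$ and $S(A_0)\subseteq A_0$. -/

import Mathlib

open scoped TensorProduct

universe u v

noncomputable section

/-! ### Ring-theoretic notions -/

/-- A (not necessarily commutative) ring is prime if it is nonzero and `a R b = 0` forces
`a = 0` or `b = 0`. -/
def IsPrimeRing (R : Type v) [Ring R] : Prop :=
  Nontrivial R ∧ ∀ a b : R, (∀ r : R, a * r * b = 0) → a = 0 ∨ b = 0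

/-- A ring is noetherian if it is left and right noetherian. -/
def IsTwoSidedNoetherian (R : Type v) [Ring R] : Prop :=
  IsNoetherianRing R ∧ IsNoetherianRing Rᵐᵒᵖ

/-- A `k`-algebra is PI if some nonzero noncommutative polynomial over `k` vanishes under every
substitution of elements of the algebra for the variables. -/
def IsPIAlgebra (k : Type u) (R : Type v) [Field k] [Ring R] [Algebra k R] : Prop :=
  ∃ f : FreeAlgebra k ℕ, f ≠ 0 ∧ ∀ x : ℕ → R, FreeAlgebra.lift k x f = 0

/-- `n` is the PI-degree of `R`: the least `n` such that `R` embeds in the ring of `n × n` matrices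
over some commutative ring. (The subring generated by all the entries is no larger than `R` or
`ℕ`, so that commutative rings in the universe of `R` suffice.) -/
def HasPIDegree (R : Type v) [Ring R] (n : ℕ) : Prop :=
  IsLeast {m : ℕ | ∃ (C : Type v) (_ : CommRing C) (f : R →+* Matrix (Fin m) (Fin m) C),
    Function.Injective f} n

/-- A ring, not known in advance to be commutative, is a (commutative) Dedekind domain. -/
def IsCommDedekindDomain (R : Type v) [Ring R] : Prop :=
  ∃ h : ∀ a b : R, a * b = b * a,
    @IsDedekindDomain R { (inferInstance : Ring R) with mul_comm := h }

/-! ### Groups of automorphisms: invariants, isotypic components, induced automorphisms -/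

section Actions

variable {k : Type u} {A : Type v} [Field k] [Ring A] [Algebra k A]

/-- The subalgebra of invariants of a group of algebra automorphisms. -/
abbrev invariants (G : Subgroup (A ≃ₐ[k] A)) : Subalgebra k A :=
  FixedPoints.subalgebra k A G

/-- The component `A_χ = {a | g a = χ(g) a for all g ∈ G}` of a character `χ` of `G`. -/
def component (G : Subgroup (A ≃ₐ[k] A)) (χ : G →* kˣ) : Submodule k A where
  carrier := {a | ∀ g : G, (g : A ≃ₐ[k] A) a = (χ g : k) • a}
  zero_mem' := by intro g; simp
  add_mem' := by
    intro a b ha hb g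
    rw [map_add, ha g, hb g, smul_add]
  smul_mem' := by
    intro c a ha g
    rw [map_smul, ha g, smul_comm]

/-- `σ` is the automorphism `κ_χ` of the invariants: `x a = σ(a) x` for all `x ∈ A_χ` and all
invariants `a`. -/
def IsKappa (G : Subgroup (A ≃ₐ[k] A)) (χ : G →* kˣ) (σ : invariants G ≃ₐ[k] invariants G) :
    Prop :=
  ∀ x ∈ component G χ, ∀ a : invariants G, x * (a : A) = (σ a : A) * x

/-- The set `K` of all the automorphisms `κ_χ`, where `χ` runs through the characters of `G`. -/
def kappaSet (G : Subgroup (A ≃ₐ[k] A)) : Set (invariants G ≃ₐ[k] invariants G) :=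
  {σ | ∃ χ : G →* kˣ, IsKappa G χ σ}

theorem mem_invariants_of_commute {G H : Subgroup (A ≃ₐ[k] A)}
    (hGH : ∀ g ∈ G, ∀ h ∈ H, g * h = h * g) {h : A ≃ₐ[k] A} (hh : h ∈ H) {a : A}
    (ha : a ∈ invariants G) : h a ∈ invariants G := by
  intro g
  have h1 : (g : A ≃ₐ[k] A) a = a := ha g
  change (g : A ≃ₐ[k] A) (h a) = h a
  have h2 : (g : A ≃ₐ[k] A) (h a) = h ((g : A ≃ₐ[k] A) a) :=
    DFunLike.congr_fun (hGH g g.2 h hh) a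
  rw [h2, h1]

/-- If `H` commutes with `G`, then `H` acts on the invariants of `G` by restriction. -/
def restrictInvariants (G H : Subgroup (A ≃ₐ[k] A))
    (hGH : ∀ g ∈ G, ∀ h ∈ H, g * h = h * g) :
    H →* (invariants G ≃ₐ[k] invariants G) where
  toFun h :=
    AlgEquiv.ofAlgHom
      ((((h : A ≃ₐ[k] A) : A →ₐ[k] A).comp (invariants G).val).codRestrict (invariants G)
        fun a => mem_invariants_of_commute hGH h.2 a.2)
      (((((h⁻¹ : H) : A ≃ₐ[k] A) : A →ₐ[k] A).comp (invariants G).val).codRestrict (invariants G)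
        fun a => mem_invariants_of_commute hGH (h⁻¹).2 a.2)
      (by
        ext a
        exact DFunLike.congr_fun (mul_inv_cancel (h : A ≃ₐ[k] A)) (a : A))
      (by
        ext a
        exact DFunLike.congr_fun (inv_mul_cancel (h : A ≃ₐ[k] A)) (a : A))
  map_one' := rfl
  map_mul' _ _ := rfl

end Actions

/-! ### Winding automorphisms of a Hopf algebra -/

section Winding

variable {k : Type u} {A : Type v} [Field k] [Ring A] [HopfAlgebra k A]

open Coalgebra HopfAlgebra

/-- `a ↦ ∑ π(a₁) a₂`. -/
def leftWindingHom (π : A →ₐ[k] k) : A →ₐ[k] A :=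
  (Algebra.TensorProduct.lid k A).toAlgHom.comp
    ((Algebra.TensorProduct.map π (AlgHom.id k A)).comp (Bialgebra.comulAlgHom k A))

/-- `a ↦ ∑ a₁ π(a₂)`. -/
def rightWindingHom (π : A →ₐ[k] k) : A →ₐ[k] A :=
  (Algebra.TensorProduct.rid k k A).toAlgHom.comp
    ((Algebra.TensorProduct.map (AlgHom.id k A) π).comp (Bialgebra.comulAlgHom k A))

theorem leftWindingHom_apply (π : A →ₐ[k] k) {a : A} {ι : Type*} (r : Repr k a ι) :
    leftWindingHom π a = ∑ i ∈ r.index, π (r.left i) • r.right i := by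
  simp [leftWindingHom, ← r.eq, map_sum]

theorem rightWindingHom_apply (π : A →ₐ[k] k) {a : A} {ι : Type*} (r : Repr k a ι) :
    rightWindingHom π a = ∑ i ∈ r.index, π (r.right i) • r.left i := by
  simp [rightWindingHom, ← r.eq, map_sum]

/-- The inverse `π ∘ S` of a character `π` of `A` with respect to convolution. -/
def characterInv (π : A →ₐ[k] k) : A →ₐ[k] k :=
  AlgHom.ofLinearMap (π.toLinearMap ∘ₗ antipode k) (by simp)
    (fun a b => by simp [antipode_mul_antidistrib, mul_comm])

theorem characterInv_apply (π : A →ₐ[k] k) (a : A) :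
    characterInv π a = π (antipode k a) := rfl

theorem leftWindingHom_comp (f g : A →ₐ[k] k) (a : A) :
    leftWindingHom g (leftWindingHom f a) =
      leftWindingHom (WithConv.toConv f * WithConv.toConv g).ofConv a := by
  let T : A ⊗[k] (A ⊗[k] A) →ₗ[k] A :=
    (TensorProduct.lid k A).toLinearMap ∘ₗ TensorProduct.map f.toLinearMap
      ((TensorProduct.lid k A).toLinearMap ∘ₗ TensorProduct.map g.toLinearMap LinearMap.id)
  have h1 : ∀ t : A ⊗[k] A, leftWindingHom g
      (TensorProduct.lid k A (TensorProduct.map f.toLinearMap LinearMap.id t)) =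
      T (comul.lTensor A t) := by
    intro t
    induction t with
    | zero => simp
    | add x y hx hy => simp only [map_add, hx, hy]
    | tmul x y => simp [T]; rfl
  have h2 : ∀ t : A ⊗[k] A, TensorProduct.lid k A (TensorProduct.map
      (WithConv.toConv f * WithConv.toConv g).ofConv.toLinearMap LinearMap.id t) =
      T (TensorProduct.assoc k A A A (comul.rTensor A t)) := by
    intro t
    induction t with
    | zero => simp
    | add x y hx hy => simp only [map_add, hx, hy]
    | tmul x y =>
      have h3 : ∀ s : A ⊗[k] A, T (TensorProduct.assoc k A A A (s ⊗ₜ y)) =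
          (Algebra.TensorProduct.lmul' k (Algebra.TensorProduct.map f g s)) • y := by
        intro s
        induction s with
        | zero => simp
        | add x y hx hy => simp only [map_add, TensorProduct.add_tmul, hx, hy, add_smul]
        | tmul u w => simp [T, smul_smul, mul_comm]
      simp [h3]; rfl
  change leftWindingHom g
      (TensorProduct.lid k A (TensorProduct.map f.toLinearMap LinearMap.id (comul a))) =
    TensorProduct.lid k A (TensorProduct.map
      (WithConv.toConv f * WithConv.toConv g).ofConv.toLinearMap LinearMap.id (comul a))
  rw [h1, h2, coassoc_apply]

theorem rightWindingHom_comp (f g : A →ₐ[k] k) (a : A) :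
    rightWindingHom f (rightWindingHom g a) =
      rightWindingHom (WithConv.toConv f * WithConv.toConv g).ofConv a := by
  let T : A ⊗[k] (A ⊗[k] A) →ₗ[k] A :=
    (TensorProduct.rid k A).toLinearMap ∘ₗ TensorProduct.map LinearMap.id
      ((TensorProduct.lid k k).toLinearMap ∘ₗ TensorProduct.map f.toLinearMap g.toLinearMap)
  have h1 : ∀ t : A ⊗[k] A, TensorProduct.rid k A (TensorProduct.map LinearMap.id
      (WithConv.toConv f * WithConv.toConv g).ofConv.toLinearMap t) =
      T (comul.lTensor A t) := by
    intro t
    induction t with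
    | zero => simp
    | add x y hx hy => simp only [map_add, hx, hy]
    | tmul x y =>
      have h3 : ∀ s : A ⊗[k] A, T (x ⊗ₜ s) =
          (Algebra.TensorProduct.lmul' k (Algebra.TensorProduct.map f g s)) • x := by
        intro s
        induction s with
        | zero => simp
        | add x y hx hy => simp only [map_add, TensorProduct.tmul_add, hx, hy, add_smul]
        | tmul u w => simp [T]
      simp [h3]; rfl
  have h2 : ∀ t : A ⊗[k] A, rightWindingHom f
      (TensorProduct.rid k A (TensorProduct.map LinearMap.id g.toLinearMap t)) =
      T (TensorProduct.assoc k A A A (comul.rTensor A t)) := by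
    intro t
    induction t with
    | zero => simp
    | add x y hx hy => simp only [map_add, hx, hy]
    | tmul x y =>
      have h3 : ∀ s : A ⊗[k] A, T (TensorProduct.assoc k A A A (s ⊗ₜ y)) =
          g y • TensorProduct.rid k A (TensorProduct.map LinearMap.id f.toLinearMap s) := by
        intro s
        induction s with
        | zero => simp
        | add x y hx hy => simp only [map_add, TensorProduct.add_tmul, hx, hy, smul_add]
        | tmul u w => simp [T, smul_smul, mul_comm]
      simp [h3]; rfl
  change rightWindingHom f
      (TensorProduct.rid k A (TensorProduct.map LinearMap.id g.toLinearMap (comul a))) =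
    TensorProduct.rid k A (TensorProduct.map LinearMap.id
      (WithConv.toConv f * WithConv.toConv g).ofConv.toLinearMap (comul a))
  rw [h1, h2, coassoc_apply]

theorem leftWindingHom_rightWindingHom (f g : A →ₐ[k] k) (a : A) :
    leftWindingHom f (rightWindingHom g a) = rightWindingHom g (leftWindingHom f a) := by
  let T : A ⊗[k] (A ⊗[k] A) →ₗ[k] A :=
    (TensorProduct.lid k A).toLinearMap ∘ₗ TensorProduct.map f.toLinearMap
      ((TensorProduct.rid k A).toLinearMap ∘ₗ TensorProduct.map LinearMap.id g.toLinearMap)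
  have h1 : ∀ t : A ⊗[k] A, rightWindingHom g
      (TensorProduct.lid k A (TensorProduct.map f.toLinearMap LinearMap.id t)) =
      T (comul.lTensor A t) := by
    intro t
    induction t with
    | zero => simp
    | add x y hx hy => simp only [map_add, hx, hy]
    | tmul x y => simp [T]; rfl
  have h2 : ∀ t : A ⊗[k] A, leftWindingHom f
      (TensorProduct.rid k A (TensorProduct.map LinearMap.id g.toLinearMap t)) =
      T (TensorProduct.assoc k A A A (comul.rTensor A t)) := by
    intro t
    induction t with
    | zero => simp
    | add x y hx hy => simp only [map_add, hx, hy]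
    | tmul x y =>
      have h3 : ∀ s : A ⊗[k] A, T (TensorProduct.assoc k A A A (s ⊗ₜ y)) =
          g y • TensorProduct.lid k A (TensorProduct.map f.toLinearMap LinearMap.id s) := by
        intro s
        induction s with
        | zero => simp
        | add x y hx hy => simp only [map_add, TensorProduct.add_tmul, hx, hy, smul_add]
        | tmul u w => simp [T, smul_smul, mul_comm]
      simp [h3]; rfl
  change leftWindingHom f
      (TensorProduct.rid k A (TensorProduct.map LinearMap.id g.toLinearMap (comul a))) =
    rightWindingHom g
      (TensorProduct.lid k A (TensorProduct.map f.toLinearMap LinearMap.id (comul a)))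
  rw [h1, h2, coassoc_apply]

theorem leftWindingHom_one (a : A) :
    leftWindingHom (1 : WithConv (A →ₐ[k] k)).ofConv a = a := by
  rw [leftWindingHom_apply _ (ℛ k a)]
  exact sum_counit_smul (ℛ k a)

theorem rightWindingHom_one (a : A) :
    rightWindingHom (1 : WithConv (A →ₐ[k] k)).ofConv a = a := by
  change TensorProduct.rid k A (counit.lTensor A (comul a)) = a
  rw [lTensor_counit_comul]
  simp

theorem characterInv_mul (π : A →ₐ[k] k) :
    WithConv.toConv (characterInv π) * WithConv.toConv π = 1 := by
  apply WithConv.ofConv_injective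
  ext a
  change (WithConv.toConv (characterInv π) * WithConv.toConv π) a = counit a
  rw [AlgHom.convMul_apply, ← (ℛ k a).eq]
  have h := congrArg π (sum_antipode_mul_eq_algebraMap_counit (ℛ k a))
  simpa [characterInv_apply, map_sum] using h

theorem mul_characterInv (π : A →ₐ[k] k) :
    WithConv.toConv π * WithConv.toConv (characterInv π) = 1 := by
  apply WithConv.ofConv_injective
  ext a
  change (WithConv.toConv π * WithConv.toConv (characterInv π)) a = counit a
  rw [AlgHom.convMul_apply, ← (ℛ k a).eq]
  have h := congrArg π (sum_mul_antipode_eq_algebraMap_counit (ℛ k a))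
  simpa [characterInv_apply, map_sum] using h

/-- The left winding automorphism `Ξˡ_π : a ↦ ∑ π(a₁) a₂`. -/
def leftWinding (π : A →ₐ[k] k) : A ≃ₐ[k] A :=
  AlgEquiv.ofAlgHom (leftWindingHom π) (leftWindingHom (characterInv π))
    (by
      ext a
      simp only [AlgHom.comp_apply, AlgHom.id_apply, leftWindingHom_comp, characterInv_mul,
        leftWindingHom_one])
    (by
      ext a
      simp only [AlgHom.comp_apply, AlgHom.id_apply, leftWindingHom_comp, mul_characterInv,
        leftWindingHom_one])

/-- The right winding automorphism `Ξʳ_π : a ↦ ∑ a₁ π(a₂)`. -/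
def rightWinding (π : A →ₐ[k] k) : A ≃ₐ[k] A :=
  AlgEquiv.ofAlgHom (rightWindingHom π) (rightWindingHom (characterInv π))
    (by
      ext a
      simp only [AlgHom.comp_apply, AlgHom.id_apply, rightWindingHom_comp, mul_characterInv,
        rightWindingHom_one])
    (by
      ext a
      simp only [AlgHom.comp_apply, AlgHom.id_apply, rightWindingHom_comp, characterInv_mul,
        rightWindingHom_one])

/-- `Gˡ_π`, the group generated by `Ξˡ_π`. -/
def leftGroup (π : A →ₐ[k] k) : Subgroup (A ≃ₐ[k] A) := Subgroup.closure {leftWinding π}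

/-- `Gʳ_π`, the group generated by `Ξʳ_π`. -/
def rightGroup (π : A →ₐ[k] k) : Subgroup (A ≃ₐ[k] A) := Subgroup.closure {rightWinding π}

/-- `G_π`, the group generated by `Gˡ_π` and `Gʳ_π`. -/
def windingGroup (π : A →ₐ[k] k) : Subgroup (A ≃ₐ[k] A) := leftGroup π ⊔ rightGroup π

theorem leftGroup_commute_rightGroup (π : A →ₐ[k] k) :
    ∀ g ∈ leftGroup π, ∀ h ∈ rightGroup π, g * h = h * g := by
  have h0 : Commute (leftWinding π) (rightWinding π) := by
    ext a
    exact leftWindingHom_rightWindingHom π π a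
  intro g hg h hh
  rw [leftGroup, Subgroup.mem_closure_singleton] at hg
  rw [rightGroup, Subgroup.mem_closure_singleton] at hh
  obtain ⟨m, rfl⟩ := hg
  obtain ⟨l, rfl⟩ := hh
  exact h0.zpow_zpow m l

/-- `A₀ˡ`, the invariants of `Gˡ_π`. -/
abbrev leftClassical (π : A →ₐ[k] k) : Subalgebra k A := invariants (leftGroup π)

/-- `A₀ʳ`, the invariants of `Gʳ_π`. -/
abbrev rightClassical (π : A →ₐ[k] k) : Subalgebra k A := invariants (rightGroup π)

/-- `A₀`, the invariants of `G_π`. -/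
abbrev classical (π : A →ₐ[k] k) : Subalgebra k A := invariants (windingGroup π)

/-- `ρˡ : Gʳ_π → Aut(A₀ˡ)`, given by restriction. -/
def rhoLeft (π : A →ₐ[k] k) :
    rightGroup π →* (leftClassical π ≃ₐ[k] leftClassical π) :=
  restrictInvariants (leftGroup π) (rightGroup π) (leftGroup_commute_rightGroup π)

/-- `ρʳ : Gˡ_π → Aut(A₀ʳ)`, given by restriction. -/
def rhoRight (π : A →ₐ[k] k) :
    leftGroup π →* (rightClassical π ≃ₐ[k] rightClassical π) :=
  restrictInvariants (rightGroup π) (leftGroup π)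
    fun g hg h hh => (leftGroup_commute_rightGroup π h hh g hg).symm

/-- `Pˡ_π`, the group generated by `ρˡ(Gʳ_π)` and `Kˡ_π`. -/
def pLeft (π : A →ₐ[k] k) : Subgroup (leftClassical π ≃ₐ[k] leftClassical π) :=
  Subgroup.closure (((rhoLeft π).range : Set _) ∪ kappaSet (leftGroup π))

/-- `Pʳ_π`, the group generated by `ρʳ(Gˡ_π)` and `Kʳ_π`. -/
def pRight (π : A →ₐ[k] k) : Subgroup (rightClassical π ≃ₐ[k] rightClassical π) :=
  Subgroup.closure (((rhoRight π).range : Set _) ∪ kappaSet (rightGroup π))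

/-- For a subalgebra `B`, the subspace `{a ∈ A | Δ(a) ∈ B ⊗ B}`. -/
def comulPreimage (B : Subalgebra k A) : Submodule k A :=
  (LinearMap.range (TensorProduct.map B.val.toLinearMap B.val.toLinearMap)).comap
    (comul : A →ₗ[k] A ⊗[k] A)

/-- A subalgebra `B` is a Hopf subalgebra if `Δ(B) ⊆ B ⊗ B` and `S(B) ⊆ B`. -/
def IsHopfSubalgebra (B : Subalgebra k A) : Prop :=
  (∀ b ∈ B, b ∈ comulPreimage B) ∧ ∀ b ∈ B, antipode k b ∈ B

end Winding

end

noncomputable section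

/-! ### Characters of a finite abelian group -/

section Duality

/-! Let `G` be `Gˡ_π` or `Gʳ_π`, a cyclic group of order `n`, invertible in `k`; its action grades
`A` by the character group of `G`. For the left group the characters `ε ∘ g` are distinct, hence
linearly independent, so some `a` has `ε(g a) = χ(g)` for all `g`. The antipode identity `∑ g(a₁)
S(a₂) = ε(g a)` then puts `1` into `A_χ A_{χ⁻¹}`; the right group is treated alike. Thus the grading
is strong. Its component of degree one is a commutative domain, on the right because the antipode,
injective by noetherianity, maps `A₀ʳ` into `A₀ˡ`. Consequently nonzero homogeneous elements are
regular, and `χ ↦ κ_χ` is a well-defined homomorphism.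

The PI-degree makes it injective (`kappa_injective`): if `κ_ν = 1`, the components with degree in
`⟨ν⟩` span a commutative ring over which `A` is, after a localization, free of rank the index of
`⟨ν⟩`, so that `A` embeds in matrices of that size. Hence the center lies in both rings of
invariants, and inside `A₀ˡ` it is the fixed ring of `Kˡ`.

The equivalences are Galois theory on the commutative domain `A₀ˡ`. `Gʳ` fixes the center, so
`ρˡ(Gʳ) ⊆ Kˡ`. An element of `Gʳ` acting trivially on `A₀ˡ` lies in `Gˡ`, so counting gives equality
exactly when `Gˡ ∩ Gʳ` is trivial; comparing fixed rings gives equality exactly when `Z(A) = A₀`.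

For the coproduct, take `g ∈ Gʳ`, write `ρˡ(g) = κ_χ` and pick a nonzero `x` in `Aˡ_χ ∩ A₀ʳ`. For `a
∈ A₀ = Z(A)`, applying `Δ` to `xa = ax` gives `(g ⊗ 1)Δ(a) · Δ(x) = Δ(a)Δ(x)`, and `Δ(x)` can be
cancelled. So `Δ(a)` is invariant under all windings in both factors. -/

theorem sum_character_eq_zero {k : Type*} [Field k] {G : Type*} [Group G] [Fintype G]
    {χ : G →* kˣ} (h : χ ≠ 1) :
    ∑ g, (χ g : k) = 0 := by
  refine sum_hom_units_eq_zero ((Units.coeHom k).comp χ) fun h' => h ?_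
  ext g
  exact DFunLike.congr_fun h' g

variable {k : Type*} [Field k] [IsAlgClosed k] {G : Type*} [Group G]

/-- The exponent divides the order, so it too is invertible in `k`. This is what makes the duality
of finite abelian groups available with values in `kˣ`. -/
theorem hasEnoughRootsOfUnity_exponent (hk : (Nat.card G : k) ≠ 0) :
    HasEnoughRootsOfUnity k (Monoid.exponent G) := by
  have : NeZero (Monoid.exponent G : k) := ⟨fun h => hk <| by
    obtain ⟨m, hm⟩ := Group.exponent_dvd_nat_card (G := G)
    rw [hm, Nat.cast_mul, h, zero_mul]⟩
  infer_instance

variable [Finite G]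

theorem finite_characters (hc : ∀ g h : G, g * h = h * g) (hk : (Nat.card G : k) ≠ 0) :
    Finite (G →* kˣ) := by
  -- Commutativity is only a proposition here; the given instance is replaced by the one underlying
  -- a commutative structure, so that no two structures compete.
  obtain ⟨inst, rfl⟩ : ∃ c : CommGroup G, c.toGroup = ‹Group G› :=
    ⟨{ ‹Group G› with mul_comm := hc }, rfl⟩
  have := hasEnoughRootsOfUnity_exponent hk
  exact Finite.of_equiv _
    (CommGroup.monoidHom_mulEquiv_of_hasEnoughRootsOfUnity G k).some.toEquiv.symm

theorem card_characters (hc : ∀ g h : G, g * h = h * g) (hk : (Nat.card G : k) ≠ 0) :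
    Nat.card (G →* kˣ) = Nat.card G := by
  obtain ⟨inst, rfl⟩ : ∃ c : CommGroup G, c.toGroup = ‹Group G› :=
    ⟨{ ‹Group G› with mul_comm := hc }, rfl⟩
  have := hasEnoughRootsOfUnity_exponent hk
  exact CommGroup.card_monoidHom_of_hasEnoughRootsOfUnity G k

theorem exists_character_ne_one (hc : ∀ g h : G, g * h = h * g) (hk : (Nat.card G : k) ≠ 0)
    {g : G} (hg : g ≠ 1) : ∃ χ : G →* kˣ, χ g ≠ 1 := by
  obtain ⟨inst, rfl⟩ : ∃ c : CommGroup G, c.toGroup = ‹Group G› :=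
    ⟨{ ‹Group G› with mul_comm := hc }, rfl⟩
  have := hasEnoughRootsOfUnity_exponent hk
  exact CommGroup.exists_apply_ne_one_of_hasEnoughRootsOfUnity G k hg

/-- Biduality; it serves to recognize an automorphism that acts by a scalar on every isotypic
component as an element of `G`. -/
theorem exists_eq_eval_character (hc : ∀ g h : G, g * h = h * g) (hk : (Nat.card G : k) ≠ 0)
    (c : (G →* kˣ) →* kˣ) : ∃ g : G, ∀ χ : G →* kˣ, χ g = c χ := by
  obtain ⟨inst, rfl⟩ : ∃ c : CommGroup G, c.toGroup = ‹Group G› :=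
    ⟨{ ‹Group G› with mul_comm := hc }, rfl⟩
  have := hasEnoughRootsOfUnity_exponent hk
  exact ⟨CommGroup.monoidHomMonoidHomEquiv G k c,
    fun χ => CommGroup.apply_monoidHomMonoidHomEquiv k χ c⟩

theorem sum_characters_apply_eq_zero (hc : ∀ g h : G, g * h = h * g)
    (hk : (Nat.card G : k) ≠ 0) [Fintype (G →* kˣ)] {g : G} (hg : g ≠ 1) :
    ∑ χ : G →* kˣ, (χ g : k) = 0 := by
  obtain ⟨χ, hχ⟩ := exists_character_ne_one hc hk hg
  refine sum_character_eq_zero (G := G →* kˣ) (χ := MonoidHom.eval g) fun h' => hχ ?_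
  exact DFunLike.congr_fun h' χ

end Duality

/-! ### Commutative domains -/

section Domains

variable {k : Type*} [Field k] {R : Type*} [Ring R] [Algebra k R]

/-- An automorphism of a commutative domain fixing the invariants of a finite group of
automorphisms belongs to that group. -/
theorem mem_of_fixes_invariants [Infinite k] [NoZeroDivisors R] [Nontrivial R]
    (hc : ∀ a b : R, a * b = b * a) (K : Subgroup (R ≃ₐ[k] R)) [Finite K] (σ : R ≃ₐ[k] R)
    (hσ : ∀ a : R, (∀ τ ∈ K, τ a = a) → σ a = a) : σ ∈ K := by
  obtain ⟨inst, rfl⟩ : ∃ c : CommRing R, c.toRing = ‹Ring R› :=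
    ⟨{ ‹Ring R› with mul_comm := hc }, rfl⟩
  have : IsDomain R := NoZeroDivisors.to_isDomain R
  have := Fintype.ofFinite K
  -- The subspaces on which `σ` agrees with a given `τ ∈ K` cover `R`: the polynomial `∏ (X - τ b)`
  -- has `K`-invariant coefficients, so `σ` permutes its roots. Over an infinite field one of these
  -- finitely many subspaces is everything.
  let p : K → Subspace k R := fun τ => LinearMap.eqLocus σ.toLinearMap τ.1.toLinearMap
  have hp : ⋃ i, (p i : Set R) = Set.univ := by
    refine Set.eq_univ_of_forall fun b => Set.mem_iUnion.2 ?_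
    have h1 : (MulSemiringAction.charpoly K b).map (σ : R →+* R) =
        MulSemiringAction.charpoly K b := by
      ext m
      rw [Polynomial.coeff_map]
      exact hσ _ fun τ hτ => MulSemiringAction.smul_coeff_charpoly b m (⟨τ, hτ⟩ : K)
    have h2 : (MulSemiringAction.charpoly K b).eval (σ b) = 0 := by
      have := MulSemiringAction.eval_charpoly K b
      rw [← h1]
      change Polynomial.eval ((σ : R →+* R) b) _ = 0
      rw [Polynomial.eval_map_apply, this, map_zero]
    rw [MulSemiringAction.charpoly_eq, Polynomial.eval_prod, Finset.prod_eq_zero_iff] at h2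
    obtain ⟨τ, -, h⟩ := h2
    refine ⟨τ, ?_⟩
    rw [Polynomial.eval_sub, Polynomial.eval_X, Polynomial.eval_C, sub_eq_zero] at h
    exact h
  obtain ⟨τ, hτ⟩ := Subspace.exists_eq_top_of_iUnion_eq_univ hp
  have : σ = τ.1 := by
    ext b
    have : b ∈ p τ := hτ ▸ Submodule.mem_top
    exact this
  exact this ▸ τ.2

theorem exists_algebraMap_eq_of_pow_eq_one [IsAlgClosed k] [NoZeroDivisors R] [Nontrivial R]
    (hc : ∀ a b : R, a * b = b * a) {c : R} {m : ℕ} (hm : 0 < m) (h : c ^ m = 1) :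
    ∃ z : k, algebraMap k R z = c := by
  obtain ⟨inst, rfl⟩ : ∃ c : CommRing R, c.toRing = ‹Ring R› :=
    ⟨{ ‹Ring R› with mul_comm := hc }, rfl⟩
  have : IsDomain R := NoZeroDivisors.to_isDomain R
  have hi : IsIntegral k c := IsIntegral.of_pow hm (h ▸ isIntegral_one)
  exact minpoly.mem_range_of_degree_eq_one k c
    (IsAlgClosed.degree_eq_one_of_irreducible k (minpoly.irreducible hi))

end Domains

/-! ### Embeddings in matrix rings -/

/-- If a ring `A` is, up to a regular scalar `b`, a free right module with basis `x` over a
commutative subring `R`, then `A` embeds in the ring of matrices over `R[1/b]`. -/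
theorem exists_matrix_embedding {A R : Type v} [Ring A] [CommRing R] (i : R →+* A)
    (hi : Function.Injective i) {J : Type*} [Fintype J] (x : J → A) (ℓ : J → A →+ R) (b : R)
    (hℓ : ∀ j y r, ℓ j (y * i r) = ℓ j y * r) (hb : ∀ y : A, y * i b = 0 → y = 0)
    (hx : ∀ j, ℓ j (x j) = b) (hx' : ∀ j j', j ≠ j' → ℓ j (x j') = 0)
    (hsum : ∀ y, ∑ j, x j * i (ℓ j y) = y * i b) :
    ∃ (C : Type v) (_ : CommRing C)
      (f : A →+* Matrix (Fin (Fintype.card J)) (Fin (Fintype.card J)) C), Function.Injective f := by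
  classical
  have hb0 : b ∈ nonZeroDivisors R := by
    rw [mem_nonZeroDivisors_iff_right]
    intro r hr
    apply hi
    rw [map_zero]
    exact hb _ (by rw [← map_mul, hr, map_zero])
  let C := Localization.Away b
  have hinj : Function.Injective (algebraMap R C) :=
    IsLocalization.injective (M := Submonoid.powers b) C (Submonoid.powers_le.2 hb0)
  let w : C := IsLocalization.Away.invSelf b
  have hw : algebraMap R C b * w = 1 := IsLocalization.Away.mul_invSelf b
  -- The functional `ℓ j` is `b` times the `j`-th coordinate. Hence `ℓ l (a * x m) / b` are the
  -- entries of left multiplication by `a`, and this identity says that they multiply as matrices.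
  have key : ∀ (a a' : A) (l m : J),
      ∑ j, ℓ l (a * x j) * ℓ j (a' * x m) = ℓ l (a * a' * x m) * b := by
    intro a a' l m
    calc _ = ∑ j, ℓ l (a * x j * i (ℓ j (a' * x m))) := by simp_rw [hℓ]
      _ = ℓ l (a * ∑ j, x j * i (ℓ j (a' * x m))) := by
          rw [Finset.mul_sum, map_sum]; simp_rw [mul_assoc]
      _ = _ := by rw [hsum, ← hℓ]; simp_rw [mul_assoc]
  let f : A →+* Matrix J J C :=
    { toFun := fun a => Matrix.of fun l m => algebraMap R C (ℓ l (a * x m)) * w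
      map_one' := by
        ext l m
        by_cases h : l = m
        · subst h; simp [hx, hw]
        · simp [hx' l m h, Matrix.one_apply_ne h]
      map_mul' := by
        intro a a'
        ext l m
        have h1 : ∀ j, algebraMap R C (ℓ l (a * x j)) * w * (algebraMap R C (ℓ j (a' * x m)) * w) =
            algebraMap R C (ℓ l (a * x j) * ℓ j (a' * x m)) * (w * w) := by
          intro j; rw [map_mul (algebraMap R C)]; ring
        simp only [Matrix.mul_apply, Matrix.of_apply, h1]
        rw [← Finset.sum_mul, ← map_sum, key, map_mul (algebraMap R C)]
        linear_combination (-algebraMap R C (ℓ l (a * a' * x m)) * w) * hw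
      map_zero' := by ext; simp
      map_add' := by intro a a'; ext; simp [add_mul] }
  have hf : Function.Injective f := by
    rw [injective_iff_map_eq_zero]
    intro a ha
    have h1 : ∀ l m, ℓ l (a * x m) = 0 := by
      intro l m
      have h2 : algebraMap R C (ℓ l (a * x m)) * w = 0 := congrFun (congrFun ha l) m
      apply hinj
      rw [map_zero]
      linear_combination (algebraMap R C b) * h2 - algebraMap R C (ℓ l (a * x m)) * hw
    have h3 : ∀ m, a * x m = 0 := by
      intro m
      apply hb
      rw [← hsum]
      simp [h1]
    have h4 : a * i b = 0 := by
      have := hsum 1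
      rw [one_mul] at this
      rw [← this, Finset.mul_sum]
      simp [← mul_assoc, h3]
    exact hb a h4
  exact ⟨C, inferInstance, ((Matrix.reindexRingEquiv C (Fintype.equivFin J)).toRingHom.comp f),
    (Matrix.reindexRingEquiv C (Fintype.equivFin J)).injective.comp hf⟩

/-! ### Isotypic components -/

/-! The group laws of the character group, for the syntactic form of its operations that arises from
the field structure of `k`. -/

namespace Character

variable {k G : Type*} [Field k] [Group G] (χ ψ : G →* kˣ)

theorem mul_inv_self : χ * χ⁻¹ = 1 := mul_inv_cancel χ

theorem inv_mul_self : χ⁻¹ * χ = 1 := inv_mul_cancel χ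

theorem inv_inv_self : χ⁻¹⁻¹ = χ := inv_inv χ

theorem one_mul_self : 1 * χ = χ := one_mul χ

theorem mul_mul_inv_self : χ * ψ * ψ⁻¹ = χ := mul_inv_cancel_right χ ψ

theorem mul_one_inv_self : χ * 1⁻¹ = χ := by ext; simp

theorem mul_comm_self : χ * ψ = ψ * χ := mul_comm χ ψ

theorem pow_zero_self : χ ^ 0 = 1 := pow_zero χ

theorem pow_succ_self (m : ℕ) : χ ^ (m + 1) = χ ^ m * χ := pow_succ χ m

end Character

section Isotypic

variable {k : Type u} {A : Type v} [Field k] [Ring A] [Algebra k A] {G : Subgroup (A ≃ₐ[k] A)}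

theorem mem_component {χ : G →* kˣ} {a : A} :
    a ∈ component G χ ↔ ∀ g : G, (g : A ≃ₐ[k] A) a = (χ g : k) • a := Iff.rfl

theorem mem_invariants {a : A} : a ∈ invariants G ↔ ∀ g : G, (g : A ≃ₐ[k] A) a = a := Iff.rfl

theorem mem_component_one {a : A} : a ∈ component G 1 ↔ a ∈ invariants G := by
  simp [mem_component, mem_invariants]

theorem mul_mem_component {χ ψ : G →* kˣ} {x y : A} (hx : x ∈ component G χ)
    (hy : y ∈ component G ψ) : x * y ∈ component G (χ * ψ) := by
  intro g
  rw [map_mul, hx g, hy g, smul_mul_smul_comm]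
  rfl

theorem pow_mem_component {χ : G →* kˣ} {x : A} (hx : x ∈ component G χ) (m : ℕ) :
    x ^ m ∈ component G (χ ^ m) := by
  induction m with
  | zero => rw [Character.pow_zero_self, pow_zero, mem_component_one]; exact one_mem _
  | succ m ih => rw [pow_succ, Character.pow_succ_self]; exact mul_mem_component ih hx

theorem mul_mem_invariants {χ : G →* kˣ} {x y : A} (hx : x ∈ component G χ)
    (hy : y ∈ component G χ⁻¹) : x * y ∈ invariants G := by
  have := mul_mem_component hx hy
  rwa [Character.mul_inv_self, mem_component_one] at this

theorem mul_mem_invariants' {χ : G →* kˣ} {x y : A} (hx : x ∈ component G χ⁻¹)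
    (hy : y ∈ component G χ) : x * y ∈ invariants G := by
  have := mul_mem_component hx hy
  rwa [Character.inv_mul_self, mem_component_one] at this

theorem invariants_mul_mem_component {χ : G →* kˣ} {b x : A} (hb : b ∈ invariants G)
    (hx : x ∈ component G χ) : b * x ∈ component G χ := by
  simpa only [Character.one_mul_self] using mul_mem_component (mem_component_one.2 hb) hx

variable (G) in
/-- The projection `a ↦ |G|⁻¹ ∑ χ(g)⁻¹ g(a)` of `A` onto the component of `χ`. -/
def isotypicProj [Finite G] (χ : G →* kˣ) : A →ₗ[k] A :=
  letI := Fintype.ofFinite G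
  (Nat.card G : k)⁻¹ • ∑ g : G, ((χ g)⁻¹ : kˣ).1 • (g : A ≃ₐ[k] A).toLinearMap

theorem isotypicProj_apply [Fintype G] (χ : G →* kˣ) (a : A) :
    isotypicProj G χ a =
      (Nat.card G : k)⁻¹ • ∑ g : G, ((χ g)⁻¹ : kˣ).1 • (g : A ≃ₐ[k] A) a := by
  rw [isotypicProj, LinearMap.smul_apply, LinearMap.sum_apply]
  congr! 2
  ext
  simp

variable [Finite G]

theorem isotypicProj_mem (χ : G →* kˣ) (a : A) : isotypicProj G χ a ∈ component G χ := by
  have := Fintype.ofFinite G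
  intro h
  rw [isotypicProj_apply, map_smul, map_sum, smul_comm]
  congr 1
  rw [Finset.smul_sum]
  refine Fintype.sum_equiv (Equiv.mulLeft h)
    (fun g : G => (h : A ≃ₐ[k] A) (((χ g)⁻¹ : kˣ).1 • (g : A ≃ₐ[k] A) a))
    (fun g : G => (χ h : k) • ((χ g)⁻¹ : kˣ).1 • (g : A ≃ₐ[k] A) a) fun g => ?_
  have h1 : ((h * g : G) : A ≃ₐ[k] A) a = (h : A ≃ₐ[k] A) ((g : A ≃ₐ[k] A) a) := rfl
  rw [map_smul, Equiv.coe_mulLeft, h1, smul_smul]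
  congr 1
  have h2 := (χ h).ne_zero
  simp only [map_mul, mul_inv_rev, Units.val_mul, Units.val_inv_eq_inv_val]
  field_simp

theorem isotypicProj_of_mem (hk : (Nat.card G : k) ≠ 0) {χ : G →* kˣ} {a : A}
    (ha : a ∈ component G χ) : isotypicProj G χ a = a := by
  have := Fintype.ofFinite G
  rw [isotypicProj_apply, Finset.sum_congr rfl fun g _ => by rw [ha g, smul_smul]]
  simp only [Units.inv_mul, one_smul, Finset.sum_const, Finset.card_univ]
  rw [← Nat.cast_smul_eq_nsmul k, smul_smul, ← Nat.card_eq_fintype_card, inv_mul_cancel₀ hk,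
    one_smul]

theorem isotypicProj_of_mem_of_ne {χ ψ : G →* kˣ} (h : χ ≠ ψ) {a : A}
    (ha : a ∈ component G ψ) : isotypicProj G χ a = 0 := by
  have := Fintype.ofFinite G
  rw [isotypicProj_apply, Finset.sum_congr rfl fun g _ => by rw [ha g, smul_smul]]
  have h1 : ∑ g : G, (((χ g)⁻¹ : kˣ) : k) * (ψ g : k) = 0 := by
    have : χ⁻¹ * ψ ≠ 1 := fun h' => h (inv_mul_eq_one.1 h')
    simpa using sum_character_eq_zero this
  rw [← Finset.sum_smul, h1, zero_smul, smul_zero]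

theorem isotypicProj_mul_right {χ ψ : G →* kˣ} {a y : A} (hy : y ∈ component G ψ) :
    isotypicProj G χ (a * y) = isotypicProj G (χ * ψ⁻¹) a * y := by
  have := Fintype.ofFinite G
  rw [isotypicProj_apply, isotypicProj_apply, smul_mul_assoc, Finset.sum_mul]
  congr 1
  refine Finset.sum_congr rfl fun g _ => ?_
  rw [map_mul, hy g, mul_smul_comm, smul_smul, smul_mul_assoc]
  congr 1
  simp [mul_comm]

theorem isotypicProj_mul_left {χ ψ : G →* kˣ} {a y : A} (hy : y ∈ component G ψ) :
    isotypicProj G χ (y * a) = y * isotypicProj G (χ * ψ⁻¹) a := by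
  have := Fintype.ofFinite G
  rw [isotypicProj_apply, isotypicProj_apply, mul_smul_comm, Finset.mul_sum]
  congr 1
  refine Finset.sum_congr rfl fun g _ => ?_
  rw [map_mul, hy g, smul_mul_assoc, smul_smul, mul_smul_comm]
  congr 1
  simp [mul_comm]

theorem isotypicProj_map (f : A →ₗ[k] A)
    (hf : ∀ g : G, ∀ a, f ((g : A ≃ₐ[k] A) a) = (g : A ≃ₐ[k] A) (f a))
    (χ : G →* kˣ) (a : A) : isotypicProj G χ (f a) = f (isotypicProj G χ a) := by
  have := Fintype.ofFinite G
  simp only [isotypicProj_apply, map_smul, map_sum, hf]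

/-- Orthogonality over the characters leaves only the term `g = 1`, with weight the number of
characters, which is the order of `G`. -/
theorem sum_isotypicProj [IsAlgClosed k] (hc : ∀ g h : G, g * h = h * g)
    (hk : (Nat.card G : k) ≠ 0) [Fintype (G →* kˣ)] (a : A) :
    ∑ χ, isotypicProj G χ a = a := by
  classical
  have := Fintype.ofFinite G
  simp only [isotypicProj_apply]
  rw [← Finset.smul_sum, Finset.sum_comm]
  have h1 : ∀ g : G, ∑ χ : G →* kˣ, ((χ g)⁻¹ : kˣ).1 • (g : A ≃ₐ[k] A) a =
      if g = 1 then (Nat.card G : k) • a else 0 := by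
    intro g
    rw [← Finset.sum_smul]
    split_ifs with hg
    · subst hg
      rw [← card_characters hc hk, Nat.card_eq_fintype_card]
      simp
    · have := sum_characters_apply_eq_zero hc hk (inv_ne_one.2 hg)
      simp only [map_inv] at this
      rw [this, zero_smul]
  simp only [h1, Finset.sum_ite_eq', Finset.mem_univ, if_true]
  rw [smul_smul, inv_mul_cancel₀ hk, one_smul]

end Isotypic

/-! ### Strongly graded actions -/

section StronglyGraded

variable {k : Type u} {A : Type v} [Field k] [Ring A] [Algebra k A]

/-- A finite abelian group `G` of automorphisms of `A`, of order invertible in `k`, for which the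
decomposition of `A` into isotypic components is a strong grading with a commutative domain as its
component of degree one. -/
structure IsStronglyGraded (G : Subgroup (A ≃ₐ[k] A)) : Prop where
  nontrivial : Nontrivial A
  finite : Finite G
  comm : ∀ g h : G, g * h = h * g
  card_ne_zero : (Nat.card G : k) ≠ 0
  exists_sum_eq_one : ∀ χ : G →* kˣ, ∃ (s : Finset (A × A)) (p q : A × A → A),
    (∀ i, p i ∈ component G χ) ∧ (∀ i, q i ∈ component G χ⁻¹) ∧ ∑ i ∈ s, p i * q i = 1
  mul_comm : ∀ a ∈ invariants G, ∀ b ∈ invariants G, a * b = b * a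
  eq_zero_or_eq_zero : ∀ a ∈ invariants G, ∀ b ∈ invariants G, a * b = 0 → a = 0 ∨ b = 0

namespace IsStronglyGraded

variable {G : Subgroup (A ≃ₐ[k] A)} (h : IsStronglyGraded G)
include h

/-- Since `1 ∈ A_{χ⁻¹} A_χ`, an element killed by all of `A_χ` is zero. -/
theorem exists_left_mul_ne_zero (χ : G →* kˣ) {x : A} (hx : x ≠ 0) :
    ∃ q ∈ component G χ, q * x ≠ 0 := by
  obtain ⟨s, p, q, hp, hq, hs⟩ := h.exists_sum_eq_one χ⁻¹
  by_contra! hn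
  apply hx
  rw [← one_mul x, ← hs, Finset.sum_mul]
  refine Finset.sum_eq_zero fun i _ => ?_
  rw [mul_assoc, hn _ (by simpa only [Character.inv_inv_self] using hq i), mul_zero]

theorem exists_right_mul_ne_zero (χ : G →* kˣ) {x : A} (hx : x ≠ 0) :
    ∃ p ∈ component G χ, x * p ≠ 0 := by
  obtain ⟨s, p, q, hp, hq, hs⟩ := h.exists_sum_eq_one χ
  by_contra! hn
  apply hx
  rw [← mul_one x, ← hs, Finset.mul_sum]
  refine Finset.sum_eq_zero fun i _ => ?_
  rw [← mul_assoc, hn _ (hp i), zero_mul]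

theorem exists_ne_zero (χ : G →* kˣ) : ∃ x ∈ component G χ, x ≠ 0 := by
  have := h.nontrivial
  obtain ⟨x, hx, h1⟩ := h.exists_left_mul_ne_zero χ one_ne_zero
  exact ⟨x, hx, by simpa using h1⟩

/-- Both factors can be moved into the invariants, a domain, by multiplying from the outside with
suitable homogeneous elements. -/
theorem homogeneous_mul_ne_zero {χ ψ : G →* kˣ} {x y : A} (hx : x ∈ component G χ)
    (hy : y ∈ component G ψ) (hx0 : x ≠ 0) (hy0 : y ≠ 0) : x * y ≠ 0 := by
  intro hxy
  obtain ⟨q, hq, hqx⟩ := h.exists_left_mul_ne_zero χ⁻¹ hx0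
  obtain ⟨p, hp, hyp⟩ := h.exists_right_mul_ne_zero ψ⁻¹ hy0
  have h1 : q * x * (y * p) = 0 := by
    rw [mul_assoc, ← mul_assoc x, hxy, zero_mul, mul_zero]
  rcases h.eq_zero_or_eq_zero _ (mul_mem_invariants' hq hx) _ (mul_mem_invariants hy hp) h1
    with h2 | h2
  · exact hqx h2
  · exact hyp h2

theorem pow_ne_zero {χ : G →* kˣ} {x : A} (hx : x ∈ component G χ) (hx0 : x ≠ 0) (m : ℕ) :
    x ^ m ≠ 0 := by
  have := h.nontrivial
  induction m with
  | zero => simp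
  | succ m ih =>
    rw [pow_succ]
    exact h.homogeneous_mul_ne_zero (pow_mem_component hx m) hx ih hx0

theorem noZeroDivisors : NoZeroDivisors (invariants G) where
  eq_zero_or_eq_zero_of_mul_eq_zero := fun {a b} hab =>
    (h.eq_zero_or_eq_zero a a.2 b b.2 (congrArg Subtype.val hab)).imp
      (fun h' => Subtype.ext h') fun h' => Subtype.ext h'

theorem nontrivial_invariants : Nontrivial (invariants G) :=
  have := h.nontrivial
  inferInstance

theorem mul_comm_invariants (a b : invariants G) : a * b = b * a :=
  Subtype.ext (h.mul_comm a a.2 b b.2)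

variable [IsAlgClosed k]

theorem eq_zero_of_isotypicProj_eq_zero [Finite G] {y : A} (hy : ∀ χ, isotypicProj G χ y = 0) :
    y = 0 := by
  have := finite_characters h.comm h.card_ne_zero
  have := Fintype.ofFinite (G →* kˣ)
  rw [← sum_isotypicProj h.comm h.card_ne_zero y]
  exact Finset.sum_eq_zero fun χ _ => hy χ

/-- Two additive maps agreeing on homogeneous elements are equal. -/
theorem ext_homogeneous {M : Type*} [AddCommMonoid M] {f f' : A →+ M}
    (hf : ∀ χ, ∀ x ∈ component G χ, f x = f' x) : f = f' := by
  have := h.finite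
  have := finite_characters h.comm h.card_ne_zero
  have := Fintype.ofFinite (G →* kˣ)
  ext a
  rw [← sum_isotypicProj h.comm h.card_ne_zero a, map_sum, map_sum]
  exact Finset.sum_congr rfl fun χ _ => hf χ _ (isotypicProj_mem χ a)

/-- Multiplication by a homogeneous element shifts degrees, so the homogeneous components of `y` are
killed one by one. -/
theorem eq_zero_of_mul_eq_zero {χ : G →* kˣ} {x y : A} (hx : x ∈ component G χ) (hx0 : x ≠ 0)
    (hy : y * x = 0) : y = 0 := by
  have := h.finite
  refine h.eq_zero_of_isotypicProj_eq_zero fun ψ => ?_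
  by_contra hn
  refine h.homogeneous_mul_ne_zero (isotypicProj_mem ψ y) hx hn hx0 ?_
  have := isotypicProj_mul_right (χ := ψ * χ) (a := y) hx
  rw [Character.mul_mul_inv_self, hy, map_zero] at this
  exact this.symm

theorem eq_zero_of_mul_eq_zero' {χ : G →* kˣ} {x y : A} (hx : x ∈ component G χ) (hx0 : x ≠ 0)
    (hy : x * y = 0) : y = 0 := by
  have := h.finite
  refine h.eq_zero_of_isotypicProj_eq_zero fun ψ => ?_
  by_contra hn
  refine h.homogeneous_mul_ne_zero hx (isotypicProj_mem ψ y) hx0 hn ?_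
  have := isotypicProj_mul_left (χ := ψ * χ) (a := y) hx
  rw [Character.mul_mul_inv_self, hy, map_zero] at this
  exact this.symm

theorem mul_right_cancel {χ : G →* kˣ} {x y z : A} (hx : x ∈ component G χ) (hx0 : x ≠ 0)
    (hy : y * x = z * x) : y = z :=
  sub_eq_zero.1 <| h.eq_zero_of_mul_eq_zero hx hx0 (by rw [sub_mul, hy, sub_self])

theorem mul_left_cancel {χ : G →* kˣ} {x y z : A} (hx : x ∈ component G χ) (hx0 : x ≠ 0)
    (hy : x * y = x * z) : y = z :=
  sub_eq_zero.1 <| h.eq_zero_of_mul_eq_zero' hx hx0 (by rw [mul_sub, hy, sub_self])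

theorem eq_of_mul_eq {χ : G →* kˣ} {a b : invariants G}
    (hab : ∀ x ∈ component G χ, (a : A) * x = b * x) : a = b := by
  obtain ⟨x, hx, hx0⟩ := h.exists_ne_zero χ
  exact Subtype.ext (h.mul_right_cancel hx hx0 (hab x hx))

/-- With `∑ pᵢ qᵢ = 1` one takes `κ_χ(a) = ∑ pᵢ a qᵢ`: each `qᵢ x` is invariant and so commutes with
`a`. The algebra laws follow by cancelling a nonzero `x ∈ A_χ`. -/
theorem exists_kappa_algHom (χ : G →* kˣ) : ∃ f : invariants G →ₐ[k] invariants G,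
    ∀ x ∈ component G χ, ∀ a : invariants G, x * (a : A) = (f a : A) * x := by
  obtain ⟨s, p, q, hp, hq, hs⟩ := h.exists_sum_eq_one χ
  have h1 : ∀ a : invariants G, ∃ c : invariants G,
      ∀ x ∈ component G χ, x * (a : A) = (c : A) * x := by
    intro a
    refine ⟨⟨∑ i ∈ s, p i * a * q i, sum_mem fun i _ => ?_⟩, fun x hx => ?_⟩
    · rw [mul_assoc]
      exact mul_mem_invariants (hp i) (invariants_mul_mem_component a.2 (hq i))
    · rw [Finset.sum_mul]
      calc x * a = ∑ i ∈ s, p i * q i * x * a := by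
            rw [← Finset.sum_mul, ← Finset.sum_mul, hs, one_mul]
        _ = _ := Finset.sum_congr rfl fun i _ => by
            rw [mul_assoc (p i), mul_assoc (p i),
              h.mul_comm _ (mul_mem_invariants' (hq i) hx) _ a.2]
            simp only [mul_assoc]
  choose f hf using h1
  refine ⟨
    { toFun := f
      map_one' := h.eq_of_mul_eq (χ := χ) fun x hx => by rw [← hf _ x hx]; simp
      map_mul' := fun a b => h.eq_of_mul_eq (χ := χ) fun x hx => by
        rw [← hf _ x hx, Subalgebra.coe_mul, Subalgebra.coe_mul, mul_assoc (f a : A), ← hf _ x hx,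
          ← mul_assoc, ← mul_assoc, hf _ x hx]
      map_zero' := h.eq_of_mul_eq (χ := χ) fun x hx => by rw [← hf _ x hx]; simp
      map_add' := fun a b => h.eq_of_mul_eq (χ := χ) fun x hx => by
        rw [← hf _ x hx, Subalgebra.coe_add, Subalgebra.coe_add, add_mul, mul_add, hf _ x hx,
          hf _ x hx]
      commutes' := fun r => h.eq_of_mul_eq (χ := χ) fun x hx => by
        rw [← hf _ x hx]
        exact (Algebra.commutes r x).symm }, fun x hx a => hf a x hx⟩

/-- `κ_χ` as an endomorphism of the invariants. -/
def kappaAlgHom (χ : G →* kˣ) : invariants G →ₐ[k] invariants G :=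
  (h.exists_kappa_algHom χ).choose

theorem mul_eq_kappaAlgHom_mul {χ : G →* kˣ} {x : A} (hx : x ∈ component G χ) (a : invariants G) :
    x * (a : A) = (h.kappaAlgHom χ a : A) * x :=
  (h.exists_kappa_algHom χ).choose_spec x hx a

theorem kappaAlgHom_mul (χ ψ : G →* kˣ) (a : invariants G) :
    h.kappaAlgHom (χ * ψ) a = h.kappaAlgHom χ (h.kappaAlgHom ψ a) := by
  obtain ⟨x, hx, hx0⟩ := h.exists_ne_zero χ
  obtain ⟨y, hy, hy0⟩ := h.exists_ne_zero ψ
  refine Subtype.ext (h.mul_right_cancel (mul_mem_component hx hy)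
    (h.homogeneous_mul_ne_zero hx hy hx0 hy0) ?_)
  rw [← h.mul_eq_kappaAlgHom_mul (mul_mem_component hx hy), mul_assoc, h.mul_eq_kappaAlgHom_mul hy,
    ← mul_assoc, h.mul_eq_kappaAlgHom_mul hx, mul_assoc]

theorem kappaAlgHom_one (a : invariants G) : h.kappaAlgHom 1 a = a := by
  refine h.eq_of_mul_eq (χ := 1) fun x hx => ?_
  rw [← h.mul_eq_kappaAlgHom_mul hx]
  exact h.mul_comm _ (mem_component_one.1 hx) _ a.2

/-- The homomorphism `χ ↦ κ_χ`. -/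
def kappa : (G →* kˣ) →* (invariants G ≃ₐ[k] invariants G) where
  toFun χ := AlgEquiv.ofAlgHom (h.kappaAlgHom χ) (h.kappaAlgHom χ⁻¹)
    (by
      ext a
      rw [AlgHom.comp_apply, ← kappaAlgHom_mul, Character.mul_inv_self, kappaAlgHom_one]
      rfl)
    (by
      ext a
      rw [AlgHom.comp_apply, ← kappaAlgHom_mul, Character.inv_mul_self, kappaAlgHom_one]
      rfl)
  map_one' := by ext a; exact congrArg Subtype.val (h.kappaAlgHom_one a)
  map_mul' χ ψ := by ext a; exact congrArg Subtype.val (h.kappaAlgHom_mul χ ψ a)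

theorem isKappa_kappa (χ : G →* kˣ) : IsKappa G χ (h.kappa χ) :=
  fun _ hx a => h.mul_eq_kappaAlgHom_mul hx a

theorem isKappa_iff {χ : G →* kˣ} {σ : invariants G ≃ₐ[k] invariants G} :
    IsKappa G χ σ ↔ σ = h.kappa χ := by
  refine ⟨fun hσ => ?_, fun hσ => hσ ▸ h.isKappa_kappa χ⟩
  ext a
  refine congrArg Subtype.val (h.eq_of_mul_eq (χ := χ) fun x hx => ?_)
  rw [← hσ x hx, h.isKappa_kappa χ x hx]

theorem existsUnique_isKappa (χ : G →* kˣ) : ∃! σ, IsKappa G χ σ :=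
  ⟨h.kappa χ, h.isKappa_kappa χ, fun _ hσ => h.isKappa_iff.1 hσ⟩

theorem kappaSet_eq : kappaSet G = (h.kappa.range : Set (invariants G ≃ₐ[k] invariants G)) := by
  ext σ
  simp only [kappaSet, h.isKappa_iff, Set.mem_ofPred_eq, MonoidHom.coe_range, Set.mem_range,
    eq_comm]

theorem finite_range_kappa : Finite h.kappa.range := by
  have := h.finite
  have := finite_characters h.comm h.card_ne_zero
  exact Set.finite_range _

end IsStronglyGraded

end StronglyGraded

/-! ### Faithfulness of `χ ↦ κ_χ`, the center, and Galois theory on the invariants. -/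

section Faithful

variable {k : Type u} {A : Type v} [Field k] [Ring A] [Algebra k A] [IsAlgClosed k]

namespace IsStronglyGraded

variable {G : Subgroup (A ≃ₐ[k] A)} (h : IsStronglyGraded G)
include h

theorem commute_of_kappa_eq_one {χ : G →* kˣ} (hχ : h.kappa χ = 1) {x b : A}
    (hx : x ∈ component G χ) (hb : b ∈ invariants G) : x * b = b * x := by
  have := h.isKappa_kappa χ x hx ⟨b, hb⟩
  rw [hχ] at this
  exact this

/-- Homogeneous elements whose degrees are powers of an element of the kernel of `κ` commute. -/
theorem commute_of_mem_powers {ν : G →* kˣ} (hν : h.kappa ν = 1) {i j : ℕ} {x y : A}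
    (hx : x ∈ component G (ν ^ i)) (hy : y ∈ component G (ν ^ j)) : x * y = y * x := by
  have := h.nontrivial
  obtain ⟨w, hw, hw0⟩ := h.exists_ne_zero ν
  have hνi : ∀ m, h.kappa (ν ^ m) = 1 := fun m => by rw [map_pow, hν, one_pow]
  -- Up to a nonzero invariant factor, every element of degree `ν ^ m` is an invariant times `w ^
  -- m`: take `b = q w ^ m` and `c = z q`. As `κ_ν = 1`, invariants commute with everything in these
  -- degrees, and so do the powers of `w` with each other.
  have key : ∀ (m : ℕ) (z : A), z ∈ component G (ν ^ m) →
      ∃ b ∈ invariants G, ∃ c ∈ invariants G, b ≠ 0 ∧ z * b = c * w ^ m := by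
    intro m z hz
    obtain ⟨q, hq, hq0⟩ := h.exists_left_mul_ne_zero (ν ^ m)⁻¹ (h.pow_ne_zero hw hw0 m)
    exact ⟨q * w ^ m, mul_mem_invariants' hq (pow_mem_component hw m), z * q,
      mul_mem_invariants hz hq, hq0, by rw [mul_assoc]⟩
  obtain ⟨b, hb, c, hc, hb0, hbc⟩ := key i x hx
  obtain ⟨b', hb', c', hc', hbne, hbc'⟩ := key j y hy
  have hyb := h.commute_of_kappa_eq_one (hνi j) hy hb
  have hxb' := h.commute_of_kappa_eq_one (hνi i) hx hb'
  have hwc' := h.commute_of_kappa_eq_one (hνi i) (pow_mem_component hw i) hc'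
  have hwc := h.commute_of_kappa_eq_one (hνi j) (pow_mem_component hw j) hc
  have e1 : x * y * (b * b') = c * c' * w ^ (i + j) := by
    calc x * y * (b * b') = x * (y * b) * b' := by simp only [mul_assoc]
      _ = (x * b) * (y * b') := by rw [hyb]; simp only [mul_assoc]
      _ = c * (w ^ i * c') * w ^ j := by rw [hbc, hbc']; simp only [mul_assoc]
      _ = _ := by rw [hwc', pow_add]; simp only [mul_assoc]
  have e2 : y * x * (b * b') = c * c' * w ^ (i + j) := by
    calc y * x * (b * b') = y * (x * b') * b := by
          rw [h.mul_comm b hb b' hb']; simp only [mul_assoc]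
      _ = (y * b') * (x * b) := by rw [hxb']; simp only [mul_assoc]
      _ = c' * (w ^ j * c) * w ^ i := by rw [hbc, hbc']; simp only [mul_assoc]
      _ = c' * c * w ^ (j + i) := by rw [hwc, pow_add]; simp only [mul_assoc]
      _ = _ := by rw [h.mul_comm c' hc' c hc, add_comm]
  refine h.mul_right_cancel (χ := 1) (mem_component_one.2 (mul_mem hb hb')) ?_ (e1.trans e2.symm)
  exact h.homogeneous_mul_ne_zero (mem_component_one.2 hb) (mem_component_one.2 hb') hb0 hbne

/-- If `κ_ν = 1`, then `A` embeds in a ring of matrices of size the index of `⟨ν⟩`. -/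
theorem exists_matrix_embedding_of_kappa_eq_one {ν : G →* kˣ} (hν : h.kappa ν = 1) :
    ∃ (C : Type v) (_ : CommRing C)
      (f : A →+* Matrix (Fin (Nat.card ((G →* kˣ) ⧸ Subgroup.zpowers ν)))
        (Fin (Nat.card ((G →* kˣ) ⧸ Subgroup.zpowers ν))) C), Function.Injective f := by
  classical
  have := h.finite
  have := finite_characters h.comm h.card_ne_zero
  set N := Subgroup.zpowers ν
  have := Fintype.ofFinite N
  have := Fintype.ofFinite ((G →* kˣ) ⧸ N)
  rw [Nat.card_eq_fintype_card]
  let s : Set A := {x | ∃ χ ∈ N, x ∈ component G χ}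
  have hs : ∀ x ∈ s, ∀ y ∈ s, x * y = y * x := by
    rintro x ⟨χ, hχ, hx⟩ y ⟨ψ, hψ, hy⟩
    obtain ⟨i, rfl⟩ := (mem_powers_iff_mem_zpowers.2 hχ)
    obtain ⟨j, rfl⟩ := (mem_powers_iff_mem_zpowers.2 hψ)
    exact h.commute_of_mem_powers hν hx hy
  let L := Algebra.adjoin k s
  let _ : CommRing L := { (inferInstance : Ring L) with
    mul_comm := (Algebra.isMulCommutative_adjoin k hs).is_comm.comm }
  have hsL : ∀ {χ : G →* kˣ} {x : A}, χ ∈ N → x ∈ component G χ → x ∈ L :=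
    fun hχ hx => Algebra.subset_adjoin ⟨_, hχ, hx⟩
  -- Projection onto the degrees in `N`; it lands in `L` and is right `L`-linear, so it yields
  -- coordinate functionals over `L`.
  let P : A →ₗ[k] A := ∑ χ : N, isotypicProj G χ.1
  have hP : ∀ a, P a = ∑ χ : N, isotypicProj G χ.1 a := fun a => LinearMap.sum_apply _ _ _
  have hPL : ∀ a, P a ∈ L := fun a => by
    rw [hP]; exact sum_mem fun χ _ => hsL χ.2 (isotypicProj_mem _ _)
  have hP1 : ∀ {χ : G →* kˣ} {x : A}, χ ∈ N → x ∈ component G χ → P x = x := by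
    intro χ x hχ hx
    rw [hP, Finset.sum_eq_single (⟨χ, hχ⟩ : N)]
    · exact isotypicProj_of_mem h.card_ne_zero hx
    · intro ψ _ hψ
      exact isotypicProj_of_mem_of_ne (fun h' => hψ (Subtype.ext h')) hx
    · simp
  have hP0 : ∀ {χ : G →* kˣ} {x : A}, χ ∉ N → x ∈ component G χ → P x = 0 := by
    intro χ x hχ hx
    rw [hP]
    refine Finset.sum_eq_zero fun ψ _ => isotypicProj_of_mem_of_ne ?_ hx
    rintro rfl
    exact hχ ψ.2
  have hPmul : ∀ l ∈ L, ∀ y, P (y * l) = P y * l := by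
    intro l hl
    induction hl using Algebra.adjoin_induction with
    | mem x hx =>
      obtain ⟨χ, hχ, hx⟩ := hx
      intro y
      rw [hP, hP, Finset.sum_mul]
      refine Fintype.sum_equiv (Equiv.mulRight (⟨χ, hχ⟩ : N)⁻¹) _ _ fun ψ => ?_
      exact isotypicProj_mul_right hx
    | algebraMap r =>
      intro y
      rw [← Algebra.commutes, ← Algebra.commutes, ← Algebra.smul_def, ← Algebra.smul_def, map_smul]
    | add x y _ _ hx hy => intro z; rw [mul_add, map_add, hx, hy, mul_add]
    | mul x y _ _ hx hy => intro z; rw [← mul_assoc, hy, hx, mul_assoc]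
  have hxq : ∀ j : (G →* kˣ) ⧸ N, ∃ x ∈ component G j.out, ∃ q ∈ component G j.out⁻¹,
      x ≠ 0 ∧ q ≠ 0 := by
    intro j
    obtain ⟨x, hx, hx0⟩ := h.exists_ne_zero j.out
    obtain ⟨q, hq, hq0⟩ := h.exists_ne_zero j.out⁻¹
    exact ⟨x, hx, q, hq, hx0, hq0⟩
  choose x hx q hq hx0 hq0 using hxq
  have hbm : ∀ j, q j * x j ∈ L := fun j =>
    hsL (one_mem N) (mem_component_one.2 (mul_mem_invariants' (hq j) (hx j)))
  -- One nonzero `x j` is chosen for each coset of `N`. The coefficient of `y` at `x j` is `P (q j *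
  -- y)` divided by the regular element `b j = q j * x j`.
  let b : (G →* kˣ) ⧸ N → L := fun j => ⟨q j * x j, hbm j⟩
  have hbreg : ∀ (t : Finset ((G →* kˣ) ⧸ N)) (y : A), y * (∏ j ∈ t, b j : L) = 0 → y = 0 := by
    intro t
    induction t using Finset.induction_on with
    | empty => intro y hy; simpa using hy
    | insert j t hj ih =>
      intro y hy
      rw [Finset.prod_insert hj] at hy
      have hy' : y * (q j * x j) * (∏ j ∈ t, b j : L) = 0 := by
        rw [mul_assoc]; exact hy
      refine h.eq_zero_of_mul_eq_zero (mem_component_one.2 (mul_mem_invariants' (hq j) (hx j)))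
        (h.homogeneous_mul_ne_zero (hq j) (hx j) (hq0 j) (hx0 j)) (ih _ hy')
  -- The product of the other denominators, so that all coordinates share the denominator `∏ b i`.
  let c : (G →* kˣ) ⧸ N → L := fun j => ∏ i ∈ Finset.univ.erase j, b i
  have hcb : ∀ j, c j * b j = ∏ i, b i := fun j =>
    Finset.prod_erase_mul _ _ (Finset.mem_univ j)
  let ℓ : (G →* kˣ) ⧸ N → A →+ L := fun j =>
    { toFun := fun y => c j * ⟨P (q j * y), hPL _⟩
      map_zero' := by
        have : (⟨P (q j * 0), hPL _⟩ : L) = 0 := Subtype.ext (by simp)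
        rw [this, mul_zero]
      map_add' := fun y z => by
        rw [← mul_add]
        congr 1
        exact Subtype.ext ((congrArg P (mul_add (q j) y z)).trans (map_add P _ _)) }
  have hmk : ∀ (j : (G →* kˣ) ⧸ N) (χ : G →* kˣ), χ * j.out⁻¹ ∈ N ↔ j = QuotientGroup.mk χ := by
    intro j χ
    conv_rhs => rw [← QuotientGroup.out_eq' j]
    rw [QuotientGroup.eq]
    rw [Character.mul_comm_self]
  have hqy : ∀ (j : (G →* kˣ) ⧸ N) {χ : G →* kˣ} {y : A}, y ∈ component G χ →
      q j * y ∈ component G (χ * j.out⁻¹) := by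
    intro j χ y hy
    rw [Character.mul_comm_self]
    exact mul_mem_component (hq j) hy
  refine exists_matrix_embedding (L.val : L →+* A) Subtype.val_injective x ℓ (∏ j, b j) ?_
    (hbreg Finset.univ) ?_ ?_ ?_
  · intro j y r
    change c j * (⟨P (q j * (y * r)), hPL _⟩ : L) = c j * ⟨P (q j * y), hPL _⟩ * r
    rw [mul_assoc]
    congr 1
    exact Subtype.ext ((congrArg P (mul_assoc (q j) y r).symm).trans (hPmul _ r.2 _))
  · intro j
    rw [← hcb j]
    change c j * (⟨P (q j * x j), hPL _⟩ : L) = c j * b j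
    congr 1
    exact Subtype.ext (hP1 (one_mem N) (mem_component_one.2 (mul_mem_invariants' (hq j) (hx j))))
  · intro j j' hj
    change c j * (⟨P (q j * x j'), hPL _⟩ : L) = 0
    have : (⟨P (q j * x j'), hPL _⟩ : L) = 0 := by
      refine Subtype.ext (hP0 (fun h' => hj ?_) (hqy j (hx j')))
      rw [(hmk _ _).1 h']
      exact QuotientGroup.out_eq' j'
    rw [this, mul_zero]
  · suffices hsuff : (∑ j, (AddMonoidHom.mulLeft (x j)).comp
        ((L.val : L →+* A).toAddMonoidHom.comp (ℓ j))) =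
        AddMonoidHom.mulRight ((∏ j, b j : L) : A) by
      intro y
      have := DFunLike.congr_fun hsuff y
      rw [AddMonoidHom.finsetSum_apply] at this
      exact this
    refine h.ext_homogeneous fun χ y hy => ?_
    rw [AddMonoidHom.finsetSum_apply, Finset.sum_eq_single (QuotientGroup.mk χ)]
    · set j : (G →* kˣ) ⧸ N := QuotientGroup.mk χ with hj
      change x j * ((c j * ⟨P (q j * y), hPL _⟩ : L) : A) = y * ((∏ j, b j : L) : A)
      have hmem : χ * j.out⁻¹ ∈ N := (hmk j χ).2 hj
      have hPy : P (q j * y) = q j * y := hP1 hmem (hqy j hy)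
      have hqyL : q j * y ∈ L := hsL hmem (hqy j hy)
      have e0 : (⟨P (q j * y), hPL _⟩ : L) = ⟨q j * y, hqyL⟩ := Subtype.ext hPy
      -- After left multiplication by `q j` both sides are products of the elements `q j * x j` and
      -- `q j * y` of the commutative ring `L`.
      have e1 : x j * (q j * y) = y * (q j * x j) := by
        refine h.mul_left_cancel (hq j) (hq0 j) ?_
        have : b j * ⟨q j * y, hqyL⟩ = ⟨q j * y, hqyL⟩ * b j := _root_.mul_comm _ _
        have : (q j * x j) * (q j * y) = (q j * y) * (q j * x j) := congrArg Subtype.val this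
        simpa only [mul_assoc] using this
      rw [e0, ← hcb j, _root_.mul_comm (c j), _root_.mul_comm (c j)]
      change x j * ((q j * y) * (c j : A)) = y * ((q j * x j) * (c j : A))
      rw [← mul_assoc, e1, mul_assoc]
    · intro j _ hj
      change x j * ((c j * ⟨P (q j * y), hPL _⟩ : L) : A) = 0
      have : (⟨P (q j * y), hPL _⟩ : L) = 0 :=
        Subtype.ext (hP0 (fun h' => hj ((hmk j χ).1 h')) (hqy j hy))
      rw [this, mul_zero]
      exact mul_zero _
    · simp

/-- A nontrivial `ν` in the kernel would embed `A` in matrices of size the index of `⟨ν⟩`, strictly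
less than `|G|`, against the minimality of the PI-degree. -/
theorem kappa_injective (hdeg : HasPIDegree A (Nat.card G)) : Function.Injective h.kappa := by
  rw [injective_iff_map_eq_one]
  intro ν hν
  by_contra hn
  have := h.finite
  have := finite_characters h.comm h.card_ne_zero
  have h1 := hdeg.2 (h.exists_matrix_embedding_of_kappa_eq_one hν)
  rw [← card_characters h.comm h.card_ne_zero,
    Subgroup.card_eq_card_quotient_mul_card_subgroup (Subgroup.zpowers ν)] at h1
  have h2 : 0 < Nat.card ((G →* kˣ) ⧸ Subgroup.zpowers ν) := Nat.card_pos
  have h3 : 1 < Nat.card (Subgroup.zpowers ν) := by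
    rw [Subgroup.one_lt_card_iff_ne_bot]
    rwa [Ne, Subgroup.zpowers_eq_bot]
  nlinarith

/-- Each homogeneous component of a central element commutes with the invariants. If it is nonzero
of degree `χ`, then `κ_χ = 1`, so `χ = 1`. -/
theorem center_le_invariants (hdeg : HasPIDegree A (Nat.card G)) :
    Subalgebra.center k A ≤ invariants G := by
  intro z hz
  rw [Subalgebra.mem_center_iff] at hz
  have := h.finite
  have := finite_characters h.comm h.card_ne_zero
  have := Fintype.ofFinite (G →* kˣ)
  rw [← sum_isotypicProj h.comm h.card_ne_zero z]
  refine sum_mem fun χ _ => ?_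
  by_cases h0 : isotypicProj G χ z = 0
  · rw [h0]; exact zero_mem _
  have h1 : h.kappa χ = 1 := by
    refine AlgEquiv.ext fun b => Subtype.ext
      (h.mul_right_cancel (isotypicProj_mem χ z) h0 ?_)
    rw [← h.isKappa_kappa χ _ (isotypicProj_mem χ z)]
    have e1 := isotypicProj_mul_right (χ := χ) (a := z) (mem_component_one.2 b.2)
    have e2 := isotypicProj_mul_left (χ := χ) (a := z) (mem_component_one.2 b.2)
    rw [Character.mul_one_inv_self] at e1 e2
    rw [← e1, ← hz, e2]
    rfl
  have h2 : χ = 1 := h.kappa_injective hdeg (h1.trans (map_one _).symm)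
  rw [← mem_component_one, ← h2]
  exact isotypicProj_mem χ z

theorem mem_center_iff (a : invariants G) :
    (a : A) ∈ Subalgebra.center k A ↔ ∀ χ, h.kappa χ a = a := by
  rw [Subalgebra.mem_center_iff]
  constructor
  · intro ha χ
    refine h.eq_of_mul_eq (χ := χ) fun x hx => ?_
    rw [← h.isKappa_kappa χ x hx, ha]
  · intro ha b
    have : AddMonoidHom.mulRight (a : A) = AddMonoidHom.mulLeft (a : A) := by
      refine h.ext_homogeneous fun χ x hx => ?_
      change x * (a : A) = a * x
      rw [h.isKappa_kappa χ x hx, ha]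
    exact DFunLike.congr_fun this b

/-- Galois correspondence for finite groups of automorphisms of the invariants. -/
theorem mem_subgroup_of_fixes (K : Subgroup (invariants G ≃ₐ[k] invariants G)) [Finite K]
    (σ : invariants G ≃ₐ[k] invariants G)
    (hσ : ∀ a, (∀ τ ∈ K, τ a = a) → σ a = a) : σ ∈ K := by
  have := h.noZeroDivisors
  have := h.nontrivial_invariants
  have : Infinite k := IsAlgClosed.instInfinite
  exact mem_of_fixes_invariants h.mul_comm_invariants K σ hσ

theorem mem_range_kappa_of_fixes_center {σ : invariants G ≃ₐ[k] invariants G}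
    (hσ : ∀ a : invariants G, (a : A) ∈ Subalgebra.center k A → σ a = a) :
    σ ∈ h.kappa.range := by
  have := h.finite_range_kappa
  refine h.mem_subgroup_of_fixes _ σ fun a ha => hσ a ?_
  rw [h.mem_center_iff]
  exact fun χ => ha _ ⟨χ, rfl⟩

/-- An automorphism of finite order which commutes with `G` and fixes the invariants of `G` belongs
to `G`. -/
theorem mem_of_fixes_invariants {f : A ≃ₐ[k] A} (hf : ∀ g ∈ G, g * f = f * g) {m : ℕ} (hm : 0 < m)
    (hfm : f ^ m = 1) (hfix : ∀ a ∈ invariants G, f a = a) : f ∈ G := by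
  have := h.nontrivial
  have := h.noZeroDivisors
  have := h.nontrivial_invariants
  have hfmem : ∀ {χ : G →* kˣ} {x : A}, x ∈ component G χ → f x ∈ component G χ := by
    intro χ x hx g
    have h1 : (g : A ≃ₐ[k] A) (f x) = f ((g : A ≃ₐ[k] A) x) := DFunLike.congr_fun (hf g g.2) x
    rw [h1, hx g, map_smul]
  -- On `A_χ` the map `f` is left multiplication by the invariant `c = ∑ f(pᵢ) qᵢ`. From `f ^ m = 1`
  -- follows `c ^ m = 1`, so `c` is algebraic over `k` and therefore a scalar.
  have hscal : ∀ χ : G →* kˣ, ∃ z : k, ∀ x ∈ component G χ, f x = z • x := by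
    intro χ
    obtain ⟨s, p, q, hp, hq, hs⟩ := h.exists_sum_eq_one χ
    let c : invariants G := ⟨∑ i ∈ s, f (p i) * q i,
      sum_mem fun i _ => mul_mem_invariants (hfmem (hp i)) (hq i)⟩
    have hc : ∀ x ∈ component G χ, f x = c * x := by
      intro x hx
      calc f x = f (∑ i ∈ s, p i * (q i * x)) := by
            simp_rw [← mul_assoc]
            rw [← Finset.sum_mul, hs, one_mul]
        _ = ∑ i ∈ s, f (p i) * (q i * x) := by
            rw [map_sum]
            exact Finset.sum_congr rfl fun i _ => by
              rw [map_mul, hfix _ (mul_mem_invariants' (hq i) hx)]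
        _ = _ := by simp only [c, ← mul_assoc, Finset.sum_mul]
    have hcm : ∀ (j : ℕ), ∀ x ∈ component G χ, (f ^ j) x = (c : A) ^ j * x := by
      intro j
      induction j with
      | zero => intro x _; simp
      | succ j ih =>
        intro x hx
        rw [pow_succ, AlgEquiv.mul_apply, ih _ (hfmem hx), hc x hx, pow_succ, mul_assoc]
    have hc1 : c ^ m = 1 := h.eq_of_mul_eq (χ := χ) fun x hx => by
      have := hcm m x hx
      rw [hfm] at this
      simpa using this.symm
    obtain ⟨z, hz⟩ := exists_algebraMap_eq_of_pow_eq_one (k := k) h.mul_comm_invariants hm hc1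
    refine ⟨z, fun x hx => ?_⟩
    rw [hc x hx, ← hz, Algebra.smul_def]
    rfl
  choose z hz using hscal
  have hz0 : ∀ χ, z χ ≠ 0 := by
    intro χ h0
    obtain ⟨x, hx, hx0⟩ := h.exists_ne_zero χ
    have := hz χ x hx
    rw [h0, zero_smul] at this
    exact hx0 (f.injective (this.trans (map_zero f).symm))
  have hsmul : ∀ {χ : G →* kˣ} {x : A} {r s : k}, x ∈ component G χ → x ≠ 0 →
      r • x = s • x → r = s := fun _ hx0 hrs => smul_left_injective k hx0 hrs
  -- The scalars depend multiplicatively on `χ`, so by biduality they are the values `χ g` at a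
  -- single `g ∈ G`.
  let c : (G →* kˣ) →* kˣ :=
    { toFun := fun χ => Units.mk0 (z χ) (hz0 χ)
      map_one' := by
        ext
        have := hz 1 1 (mem_component_one.2 (one_mem _))
        rw [map_one] at this
        refine hsmul (χ := 1) (mem_component_one.2 (one_mem _)) one_ne_zero ?_
        rw [Units.val_mk0, ← this, Units.val_one, one_smul]
      map_mul' := fun χ ψ => by
        ext
        obtain ⟨x, hx, hx0⟩ := h.exists_ne_zero χ
        obtain ⟨y, hy, hy0⟩ := h.exists_ne_zero ψ
        refine hsmul (mul_mem_component hx hy) (h.homogeneous_mul_ne_zero hx hy hx0 hy0) ?_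
        rw [Units.val_mk0, ← hz _ _ (mul_mem_component hx hy), map_mul, hz χ x hx, hz ψ y hy,
          smul_mul_smul_comm]
        rfl }
  have := h.finite
  obtain ⟨g, hg⟩ := exists_eq_eval_character h.comm h.card_ne_zero c
  have hfg : (f : A →+* A).toAddMonoidHom = ((g : A ≃ₐ[k] A) : A →+* A).toAddMonoidHom := by
    refine h.ext_homogeneous fun χ x hx => ?_
    change f x = (g : A ≃ₐ[k] A) x
    rw [hz χ x hx, hx g, hg]
    rfl
  have : f = g := AlgEquiv.ext fun x => DFunLike.congr_fun hfg x
  rw [this]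
  exact g.2

end IsStronglyGraded

end Faithful

/-! ### The antipode -/

section Antipode

open Coalgebra HopfAlgebra WithConv

variable {k : Type u} {A : Type v} [Field k] [Ring A] [HopfAlgebra k A]

theorem toConv_comp_antipode_mul {B : Type*} [Ring B] [Algebra k B] (f : A →ₐ[k] B) :
    toConv (f.toLinearMap ∘ₗ antipode k) * toConv f.toLinearMap = 1 := by
  ext a
  rw [(ℛ k a).convMul_apply]
  have h := congrArg f (sum_antipode_mul_eq_algebraMap_counit (ℛ k a))
  simpa [map_sum] using h

theorem toConv_mul_comp_antipode {B : Type*} [Ring B] [Algebra k B] (f : A →ₐ[k] B) :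
    toConv f.toLinearMap * toConv (f.toLinearMap ∘ₗ antipode k) = 1 := by
  ext a
  rw [(ℛ k a).convMul_apply]
  have h := congrArg f (sum_mul_antipode_eq_algebraMap_counit (ℛ k a))
  simpa [map_sum] using h

/-- The antipode is an antimorphism of coalgebras. -/
theorem comul_antipode (a : A) :
    comul (R := k) (antipode k a) =
      TensorProduct.map (antipode k) (antipode k) (TensorProduct.comm k A A (comul a)) := by
  let i₁ : A →ₐ[k] A ⊗[k] A := Algebra.TensorProduct.includeLeft
  let i₂ : A →ₐ[k] A ⊗[k] A := Algebra.TensorProduct.includeRight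
  -- `Δ` is the convolution product of the two inclusions, so its convolution inverse `Δ ∘ S` is the
  -- product of their inverses in the opposite order.
  have h1 : toConv (Bialgebra.comulAlgHom k A).toLinearMap =
      toConv i₁.toLinearMap * toConv i₂.toLinearMap := by
    ext a
    rw [(ℛ k a).convMul_apply]
    simp [i₁, i₂, (ℛ k a).eq]
  have h2 : toConv ((Bialgebra.comulAlgHom k A).toLinearMap ∘ₗ antipode k) =
      toConv (i₂.toLinearMap ∘ₗ antipode k) * toConv (i₁.toLinearMap ∘ₗ antipode k) := by
    refine left_inv_eq_right_inv (toConv_comp_antipode_mul (Bialgebra.comulAlgHom k A)) ?_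
    rw [h1, mul_assoc, ← mul_assoc (toConv i₂.toLinearMap), toConv_mul_comp_antipode, one_mul,
      toConv_mul_comp_antipode]
  have h3 := congrArg (fun f => f a) h2
  simp only at h3
  rw [(ℛ k a).convMul_apply] at h3
  rw [← (ℛ k a).eq]
  simpa [i₁, i₂] using h3

/-- The left `A`-linear extension `a ⊗ c ↦ a f(c)` of a linear map `f : A → A ⊗ A`. -/
def leftExtend (f : A →ₗ[k] A ⊗[k] A) : A ⊗[k] A →ₗ[A] A ⊗[k] A :=
  TensorProduct.AlgebraTensorModule.lift (LinearMap.toSpanSingleton A (A →ₗ[k] A ⊗[k] A) f)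

@[simp]
theorem leftExtend_tmul (f : A →ₗ[k] A ⊗[k] A) (a c : A) : leftExtend f (a ⊗ₜ c) = a • f c := rfl

/-- By coassociativity these extensions act as right convolution. With `H = id` and `H = S` this
makes the two Galois maps mutually inverse. -/
theorem leftExtend_convolution (F H : WithConv (A →ₗ[k] A)) (c : A) :
    leftExtend (H.ofConv.rTensor A ∘ₗ comul) (F.ofConv.rTensor A (comul c)) =
      (F * H).ofConv.rTensor A (comul c) := by
  let T : A ⊗[k] (A ⊗[k] A) →ₗ[k] A ⊗[k] A :=
    (LinearMap.mul' k A).rTensor A ∘ₗ (TensorProduct.assoc k A A A).symm.toLinearMap ∘ₗ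
      TensorProduct.map F.ofConv (H.ofConv.rTensor A)
  have h1 : ∀ t : A ⊗[k] A, leftExtend (H.ofConv.rTensor A ∘ₗ comul) (F.ofConv.rTensor A t) =
      T (comul.lTensor A t) := by
    intro t
    induction t with
    | zero => simp
    | add x y hx hy => simp only [map_add, hx, hy]
    | tmul x y =>
      have h3 : ∀ s : A ⊗[k] A, F.ofConv x • H.ofConv.rTensor A s = T (x ⊗ₜ s) := by
        intro s
        induction s with
        | zero => simp
        | add x y hx hy => simp only [map_add, TensorProduct.tmul_add, hx, hy, smul_add]
        | tmul u w => simp [T, TensorProduct.smul_tmul']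
      simpa using h3 (comul y)
  have h2 : ∀ t : A ⊗[k] A, (F * H).ofConv.rTensor A t =
      T (TensorProduct.assoc k A A A (comul.rTensor A t)) := by
    intro t
    induction t with
    | zero => simp
    | add x y hx hy => simp only [map_add, hx, hy]
    | tmul x y =>
      have h3 : ∀ s : A ⊗[k] A, T (TensorProduct.assoc k A A A (s ⊗ₜ y)) =
          LinearMap.mul' k A (TensorProduct.map F.ofConv H.ofConv s) ⊗ₜ y := by
        intro s
        induction s with
        | zero => simp
        | add x y hx hy => simp only [map_add, TensorProduct.add_tmul, hx, hy]
        | tmul u w => simp [T]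
      rw [LinearMap.rTensor_tmul, LinearMap.rTensor_tmul, h3]
      rfl
  rw [h1, h2, coassoc_apply]

variable (k A) in
/-- `a ⊗ c ↦ a c₁ ⊗ c₂`. -/
def galoisMap : A ⊗[k] A →ₗ[A] A ⊗[k] A := leftExtend comul

variable (k A) in
/-- `a ⊗ c ↦ a S(c₁) ⊗ c₂`. -/
def galoisInv : A ⊗[k] A →ₗ[A] A ⊗[k] A := leftExtend ((antipode k).rTensor A ∘ₗ comul)

theorem galoisMap_convolution (F : WithConv (A →ₗ[k] A)) (c : A) :
    galoisMap k A (F.ofConv.rTensor A (comul c)) =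
      (F * toConv LinearMap.id).ofConv.rTensor A (comul c) := by
  have := leftExtend_convolution F (toConv LinearMap.id) c
  rw [ofConv_toConv, LinearMap.rTensor_id, LinearMap.id_comp] at this
  exact this

theorem galoisInv_convolution (F : WithConv (A →ₗ[k] A)) (c : A) :
    galoisInv k A (F.ofConv.rTensor A (comul c)) =
      (F * toConv (antipode k)).ofConv.rTensor A (comul c) :=
  leftExtend_convolution F (toConv (antipode k)) c

theorem rTensor_convOne_comul (c : A) :
    (1 : WithConv (A →ₗ[k] A)).ofConv.rTensor A (comul c) = 1 ⊗ₜ[k] c := by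
  rw [LinearMap.convOne_def, ofConv_toConv, LinearMap.rTensor_comp, LinearMap.comp_apply,
    rTensor_counit_comul]
  simp

theorem galoisMap_galoisInv (t : A ⊗[k] A) : galoisMap k A (galoisInv k A t) = t := by
  induction t with
  | zero => simp
  | add x y hx hy => simp only [map_add, hx, hy]
  | tmul a c =>
    have h1 : a ⊗ₜ[k] c = a • (1 ⊗ₜ[k] c) := by simp [TensorProduct.smul_tmul']
    rw [h1, map_smul, map_smul, ← rTensor_convOne_comul c, galoisInv_convolution,
      galoisMap_convolution, one_mul, LinearMap.antipode_mul_id]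

theorem galoisInv_galoisMap (t : A ⊗[k] A) : galoisInv k A (galoisMap k A t) = t := by
  induction t with
  | zero => simp
  | add x y hx hy => simp only [map_add, hx, hy]
  | tmul a c =>
    have h1 : a ⊗ₜ[k] c = a • (1 ⊗ₜ[k] c) := by simp [TensorProduct.smul_tmul']
    rw [h1, map_smul, map_smul, ← rTensor_convOne_comul c, galoisMap_convolution,
      galoisInv_convolution, one_mul, LinearMap.id_mul_antipode]

/-- The antipode of a left noetherian Hopf algebra is injective. -/
theorem antipode_injective [IsNoetherianRing A] :
    Function.Injective (antipode k : A →ₗ[k] A) := by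
  rw [injective_iff_map_eq_zero]
  intro c hc
  -- The orbit of `1 ⊗ c` under the Galois map. It stays in a finitely generated left `A`-module, so
  -- some `t (m + 1)` is a combination of `t 0, …, t m`. Applying the inverse map `m` times
  -- expresses `t 1 = Δ(c)` through backward iterates of `1 ⊗ c`.
  let t : ℕ → A ⊗[k] A := fun m =>
    (toConv (LinearMap.id : A →ₗ[k] A) ^ m).ofConv.rTensor A (comul c)
  have ht0 : t 0 = 1 ⊗ₜ c := by
    simp only [t, pow_zero]
    exact rTensor_convOne_comul c
  have ht1 : t 1 = comul c := by simp [t]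
  have hInv : ∀ m, galoisInv k A (t (m + 1)) = t m := by
    intro m
    rw [show t (m + 1) = galoisMap k A (t m) by
      simp only [t, galoisMap_convolution, pow_succ], galoisInv_galoisMap]
  have hInvIter : ∀ m l, (galoisInv k A ^ m) (t (m + l)) = t l := by
    intro m
    induction m with
    | zero => intro l; simp
    | succ m ih =>
      intro l
      rw [pow_succ, Module.End.mul_apply, show m + 1 + l = m + l + 1 by omega, hInv, ih]
  let S₂ : A ⊗[k] A →ₗ[A] A ⊗[k] A := leftExtend (TensorProduct.mk k A A 1 ∘ₗ antipode k)
  have hS₂ : ∀ s, S₂ s = (antipode k).lTensor A s := by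
    intro s
    induction s with
    | zero => simp
    | add x y hx hy => simp only [map_add, hx, hy]
    | tmul x y => simp [S₂, TensorProduct.smul_tmul']
  let φ : A ⊗[k] A →ₗ[A] A ⊗[k] A :=
    leftExtend ((TensorProduct.comm k A A).toLinearMap ∘ₗ comul)
  -- Since `S` reverses `Δ`, the map `1 ⊗ S` carries the inverse Galois map to `φ`. Hence it kills
  -- all backward iterates of `1 ⊗ c`, given `S(c) = 0`.
  have hφ : ∀ s, S₂ (galoisInv k A s) = φ (S₂ s) := by
    intro s
    induction s with
    | zero => simp
    | add x y hx hy => simp only [map_add, hx, hy]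
    | tmul a y =>
      have h1 : S₂ ((antipode k).rTensor A (comul y)) =
          TensorProduct.comm k A A (comul (antipode k y)) := by
        rw [hS₂, comul_antipode, ← (ℛ k y).eq]
        simp [map_sum]
      rw [hS₂ (a ⊗ₜ y), LinearMap.lTensor_tmul]
      simp only [galoisInv, φ, leftExtend_tmul, map_smul, LinearMap.comp_apply]
      rw [h1]
      rfl
  have hker : ∀ m, S₂ ((galoisInv k A ^ m) (t 0)) = 0 := by
    intro m
    induction m with
    | zero =>
      rw [pow_zero, Module.End.one_apply, ht0, hS₂, LinearMap.lTensor_tmul, hc,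
        TensorProduct.tmul_zero]
    | succ m ih => rw [pow_succ', Module.End.mul_apply, hφ, ih, map_zero]
  let M : Submodule A (A ⊗[k] A) :=
    Submodule.span A ((fun i => (1 : A) ⊗ₜ[k] (ℛ k c).right i) '' (ℛ k c).index)
  have : IsNoetherian A M := isNoetherian_span_of_finite A ((Finset.finite_toSet _).image _)
  have htM : ∀ m, t m ∈ M := by
    intro m
    simp only [t]
    rw [← (ℛ k c).eq, map_sum]
    refine sum_mem fun i hi => ?_
    rw [LinearMap.rTensor_tmul, show ∀ x y : A, x ⊗ₜ[k] y = x • (1 ⊗ₜ[k] y) by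
      simp [TensorProduct.smul_tmul']]
    exact Submodule.smul_mem _ _ (Submodule.subset_span ⟨i, hi, rfl⟩)
  let f : ℕ →o Submodule A M :=
    { toFun := fun m => Submodule.span A ((fun i => (⟨t i, htM i⟩ : M)) '' Set.Iic m)
      monotone' := fun m l hml => Submodule.span_mono (Set.image_mono (Set.Iic_subset_Iic.2 hml)) }
  obtain ⟨m, hm⟩ := monotone_stabilizes_iff_noetherian.2 this f
  have hmem : (⟨t (m + 1), htM _⟩ : M) ∈ f m := by
    rw [hm (m + 1) (Nat.le_succ m)]
    exact Submodule.subset_span ⟨m + 1, Set.mem_Iic.2 le_rfl, rfl⟩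
  have hle : f m ≤ LinearMap.ker (S₂ ∘ₗ (galoisInv k A ^ m) ∘ₗ M.subtype) := by
    refine Submodule.span_le.2 ?_
    rintro _ ⟨i, hi, rfl⟩
    obtain ⟨j, rfl⟩ := Nat.exists_eq_add_of_le (Set.mem_Iic.1 hi)
    change S₂ ((galoisInv k A ^ (i + j)) (t i)) = 0
    have := hInvIter i 0
    rw [add_zero] at this
    rw [add_comm, pow_add, Module.End.mul_apply, this, hker]
  have h0 : S₂ (t 1) = 0 := by
    have : S₂ ((galoisInv k A ^ m) (t (m + 1))) = 0 := hle hmem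
    rwa [hInvIter] at this
  rw [ht1, hS₂] at h0
  -- As `ε ∘ S = ε`, applying the counit to the second factor of `(1 ⊗ S)Δ(c) = 0` returns `c = 0`.
  have h1 := congrArg (counit.lTensor A : A ⊗[k] A →ₗ[k] A ⊗[k] k) h0
  rw [← LinearMap.comp_apply, ← LinearMap.lTensor_comp, counit_comp_antipode,
    lTensor_counit_comul, map_zero] at h1
  have h2 := congrArg (TensorProduct.rid k A) h1
  simpa using h2

/-- If right multiplication by `x` is injective on `A`, then so is right multiplication by `Δ(x)`
on `A ⊗ A`. -/
theorem eq_zero_of_mul_comul_eq_zero {x : A} (hx : ∀ y : A, y * x = 0 → y = 0)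
    {t : A ⊗[k] A} (ht : t * comul (R := k) x = 0) : t = 0 := by
  -- The Galois map carries right multiplication by `1 ⊗ x`, injective by flatness, to right
  -- multiplication by `Δ(x)`.
  have h1 : ∀ s : A ⊗[k] A, galoisMap k A s * comul (R := k) x =
      galoisMap k A ((LinearMap.mulRight k x).lTensor A s) := by
    intro s
    induction s with
    | zero => simp
    | add y z hy hz => simp only [map_add, add_mul, hy, hz]
    | tmul a c => simp [galoisMap, smul_mul_assoc]
  have h2 := h1 (galoisInv k A t)
  rw [galoisMap_galoisInv, ht] at h2
  have h3 := congrArg (galoisInv k A) h2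
  rw [galoisInv_galoisMap, map_zero] at h3
  have hinj : Function.Injective ((LinearMap.mulRight k x).lTensor A) :=
    Module.Flat.lTensor_preserves_injective_linearMap _
      ((injective_iff_map_eq_zero _).2 fun y hy => hx y hy)
  have h4 : galoisInv k A t = 0 := hinj (h3.symm.trans (map_zero _).symm)
  rw [← galoisMap_galoisInv t, h4, map_zero]

end Antipode

/-! ### Groups of winding automorphisms -/

section WindingGroups

open Coalgebra HopfAlgebra WithConv

variable {k : Type u} {A : Type v} [Field k] [Ring A] [HopfAlgebra k A]

theorem comul_leftWinding (π : A →ₐ[k] k) (a : A) :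
    comul (R := k) (leftWinding π a) = (leftWinding π).toLinearMap.rTensor A (comul a) := by
  let T : A ⊗[k] (A ⊗[k] A) →ₗ[k] A ⊗[k] A :=
    (TensorProduct.lid k (A ⊗[k] A)).toLinearMap ∘ₗ π.toLinearMap.rTensor (A ⊗[k] A)
  have h1 : ∀ t : A ⊗[k] A, comul (R := k)
      (TensorProduct.lid k A (TensorProduct.map π.toLinearMap LinearMap.id t)) =
      T (comul.lTensor A t) := by
    intro t
    induction t with
    | zero => simp
    | add x y hx hy => simp only [map_add, hx, hy]
    | tmul x y => simp [T]
  have h2 : ∀ t : A ⊗[k] A, (leftWinding π).toLinearMap.rTensor A t =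
      T (TensorProduct.assoc k A A A (comul.rTensor A t)) := by
    intro t
    induction t with
    | zero => simp
    | add x y hx hy => simp only [map_add, hx, hy]
    | tmul x y =>
      have h3 : ∀ s : A ⊗[k] A, T (TensorProduct.assoc k A A A (s ⊗ₜ y)) =
          TensorProduct.lid k A (TensorProduct.map π.toLinearMap LinearMap.id s) ⊗ₜ y := by
        intro s
        induction s with
        | zero => simp
        | add x y hx hy => simp only [map_add, TensorProduct.add_tmul, hx, hy]
        | tmul u w => simp [T, TensorProduct.smul_tmul']
      rw [LinearMap.rTensor_tmul, LinearMap.rTensor_tmul, h3]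
      rfl
  rw [h2, coassoc_apply, ← h1]
  rfl

theorem comul_rightWinding (π : A →ₐ[k] k) (a : A) :
    comul (R := k) (rightWinding π a) = (rightWinding π).toLinearMap.lTensor A (comul a) := by
  let T : A ⊗[k] (A ⊗[k] A) →ₗ[k] A ⊗[k] A :=
    ((TensorProduct.rid k A).toLinearMap ∘ₗ π.toLinearMap.lTensor A).lTensor A
  have h1 : ∀ t : A ⊗[k] A, comul (R := k)
      (TensorProduct.rid k A (TensorProduct.map LinearMap.id π.toLinearMap t)) =
      T (TensorProduct.assoc k A A A (comul.rTensor A t)) := by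
    intro t
    induction t with
    | zero => simp
    | add x y hx hy => simp only [map_add, hx, hy]
    | tmul x y =>
      have h3 : ∀ s : A ⊗[k] A, T (TensorProduct.assoc k A A A (s ⊗ₜ y)) = π y • s := by
        intro s
        induction s with
        | zero => simp
        | add x y hx hy => simp only [map_add, TensorProduct.add_tmul, hx, hy, smul_add]
        | tmul u w => simp [T]
      rw [LinearMap.rTensor_tmul, h3]
      simp
  have h2 : ∀ t : A ⊗[k] A, (rightWinding π).toLinearMap.lTensor A t =
      T (comul.lTensor A t) := by
    intro t
    induction t with
    | zero => simp
    | add x y hx hy => simp only [map_add, hx, hy]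
    | tmul x y => rfl
  rw [h2, ← coassoc_apply, ← h1]
  rfl

/-- Both sides are `∑ a₁ ⊗ π(a₂) a₃`. This converts right-winding invariance in the first factor
into left-winding invariance in the second. -/
theorem rTensor_rightWinding_comul (π : A →ₐ[k] k) (a : A) :
    (rightWinding π).toLinearMap.rTensor A (comul a) =
      (leftWinding π).toLinearMap.lTensor A (comul (R := k) a) := by
  let T : A ⊗[k] (A ⊗[k] A) →ₗ[k] A ⊗[k] A :=
    ((TensorProduct.lid k A).toLinearMap ∘ₗ π.toLinearMap.rTensor A).lTensor A
  have h1 : ∀ t : A ⊗[k] A, (rightWinding π).toLinearMap.rTensor A t =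
      T (TensorProduct.assoc k A A A (comul.rTensor A t)) := by
    intro t
    induction t with
    | zero => simp
    | add x y hx hy => simp only [map_add, hx, hy]
    | tmul x y =>
      have h3 : ∀ s : A ⊗[k] A, T (TensorProduct.assoc k A A A (s ⊗ₜ y)) =
          TensorProduct.rid k A (TensorProduct.map LinearMap.id π.toLinearMap s) ⊗ₜ y := by
        intro s
        induction s with
        | zero => simp
        | add x y hx hy => simp only [map_add, TensorProduct.add_tmul, hx, hy]
        | tmul u w => simp [T, TensorProduct.smul_tmul]
      rw [LinearMap.rTensor_tmul, LinearMap.rTensor_tmul, h3]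
      rfl
  have h2 : ∀ t : A ⊗[k] A, (leftWinding π).toLinearMap.lTensor A t =
      T (comul.lTensor A t) := by
    intro t
    induction t with
    | zero => simp
    | add x y hx hy => simp only [map_add, hx, hy]
    | tmul x y => rfl
  rw [h1, h2, coassoc_apply]

theorem comul_of_mem_leftGroup {π : A →ₐ[k] k} {g : A ≃ₐ[k] A} (hg : g ∈ leftGroup π) :
    ∀ a : A, comul (R := k) (g a) = g.toLinearMap.rTensor A (comul a) := by
  induction hg using Subgroup.closure_induction with
  | mem g hg => rw [Set.mem_singleton_iff.1 hg]; exact comul_leftWinding π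
  | one => intro a; exact (LinearMap.rTensor_id_apply A A (comul a)).symm
  | mul g f _ _ hg hf =>
    intro a
    rw [AlgEquiv.mul_apply, hg, hf, ← LinearMap.rTensor_comp_apply]
    rfl
  | inv g _ hg =>
    intro a
    have h1 := hg (g⁻¹ a)
    rw [← AlgEquiv.mul_apply, mul_inv_cancel, AlgEquiv.one_apply] at h1
    rw [h1, ← LinearMap.rTensor_comp_apply]
    have h2 : (g⁻¹).toLinearMap ∘ₗ g.toLinearMap = (LinearMap.id : A →ₗ[k] A) := by
      ext x
      exact DFunLike.congr_fun (inv_mul_cancel g) x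
    rw [h2, LinearMap.rTensor_id_apply]

theorem comul_of_mem_rightGroup {π : A →ₐ[k] k} {g : A ≃ₐ[k] A} (hg : g ∈ rightGroup π) :
    ∀ a : A, comul (R := k) (g a) = g.toLinearMap.lTensor A (comul a) := by
  induction hg using Subgroup.closure_induction with
  | mem g hg => rw [Set.mem_singleton_iff.1 hg]; exact comul_rightWinding π
  | one => intro a; exact (LinearMap.lTensor_id_apply A A (comul a)).symm
  | mul g f _ _ hg hf =>
    intro a
    rw [AlgEquiv.mul_apply, hg, hf, ← LinearMap.lTensor_comp_apply]
    rfl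
  | inv g _ hg =>
    intro a
    have h1 := hg (g⁻¹ a)
    rw [← AlgEquiv.mul_apply, mul_inv_cancel, AlgEquiv.one_apply] at h1
    rw [h1, ← LinearMap.lTensor_comp_apply]
    have h2 : (g⁻¹).toLinearMap ∘ₗ g.toLinearMap = (LinearMap.id : A →ₗ[k] A) := by
      ext x
      exact DFunLike.congr_fun (inv_mul_cancel g) x
    rw [h2, LinearMap.lTensor_id_apply]

theorem counit_leftWinding (f : A →ₐ[k] k) (a : A) : counit (R := k) (leftWinding f a) = f a := by
  have h1 := congrArg f (rightWindingHom_one (k := k) a)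
  rw [rightWindingHom_apply _ (ℛ k a)] at h1
  change counit (R := k) (leftWindingHom f a) = f a
  rw [leftWindingHom_apply _ (ℛ k a), ← h1]
  simp only [map_sum, map_smul, smul_eq_mul]
  exact Finset.sum_congr rfl fun i _ => mul_comm _ _

theorem counit_rightWinding (f : A →ₐ[k] k) (a : A) : counit (R := k) (rightWinding f a) = f a := by
  have h1 := congrArg f (leftWindingHom_one (k := k) a)
  rw [leftWindingHom_apply _ (ℛ k a)] at h1
  change counit (R := k) (rightWindingHom f a) = f a
  rw [rightWindingHom_apply _ (ℛ k a), ← h1]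
  simp only [map_sum, map_smul, smul_eq_mul]
  exact Finset.sum_congr rfl fun i _ => mul_comm _ _

theorem leftWinding_pow (π : A →ₐ[k] k) (m : ℕ) :
    leftWinding π ^ m = leftWinding (toConv π ^ m).ofConv := by
  induction m with
  | zero =>
    ext a
    rw [pow_zero, pow_zero]
    exact (leftWindingHom_one a).symm
  | succ m ih =>
    ext a
    -- Left winding reverses convolution products, hence the other expansion of the power of `π`.
    rw [pow_succ, ih, pow_succ']
    exact leftWindingHom_comp π (toConv π ^ m).ofConv a

theorem rightWinding_pow (π : A →ₐ[k] k) (m : ℕ) :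
    rightWinding π ^ m = rightWinding (toConv π ^ m).ofConv := by
  induction m with
  | zero =>
    ext a
    rw [pow_zero, pow_zero]
    exact (rightWindingHom_one a).symm
  | succ m ih =>
    ext a
    rw [pow_succ, ih, pow_succ]
    exact rightWindingHom_comp (toConv π ^ m).ofConv π a

theorem leftWinding_eq_one_iff (f : WithConv (A →ₐ[k] k)) : leftWinding f.ofConv = 1 ↔ f = 1 := by
  constructor
  · intro h
    apply WithConv.ofConv_injective
    ext a
    rw [← counit_leftWinding, h]
    rfl
  · rintro rfl
    ext a
    exact leftWindingHom_one a

theorem rightWinding_eq_one_iff (f : WithConv (A →ₐ[k] k)) :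
    rightWinding f.ofConv = 1 ↔ f = 1 := by
  constructor
  · intro h
    apply WithConv.ofConv_injective
    ext a
    rw [← counit_rightWinding, h]
    rfl
  · rintro rfl
    ext a
    exact rightWindingHom_one a

theorem card_leftGroup (π : A →ₐ[k] k) : Nat.card (leftGroup π) = orderOf (toConv π) := by
  rw [leftGroup, ← Subgroup.zpowers_eq_closure, Nat.card_zpowers]
  refine orderOf_eq_orderOf_iff.2 fun m => ?_
  rw [leftWinding_pow, leftWinding_eq_one_iff]

theorem card_rightGroup (π : A →ₐ[k] k) : Nat.card (rightGroup π) = orderOf (toConv π) := by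
  rw [rightGroup, ← Subgroup.zpowers_eq_closure, Nat.card_zpowers]
  refine orderOf_eq_orderOf_iff.2 fun m => ?_
  rw [rightWinding_pow, rightWinding_eq_one_iff]

theorem mul_comm_of_closure_singleton {H : Type*} [Group H] (x : H)
    (g h : Subgroup.closure {x}) : g * h = h * g := by
  obtain ⟨i, hi⟩ := Subgroup.mem_closure_singleton.1 g.2
  obtain ⟨j, hj⟩ := Subgroup.mem_closure_singleton.1 h.2
  ext
  rw [Subgroup.coe_mul, Subgroup.coe_mul, ← hi, ← hj, ← zpow_add, ← zpow_add, add_comm]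

theorem mem_invariants_closure {R : Type*} [Ring R] [Algebra k R] {x : R ≃ₐ[k] R} {a : R} :
    a ∈ invariants (Subgroup.closure {x}) ↔ x a = a := by
  constructor
  · intro h
    exact h ⟨x, Subgroup.subset_closure rfl⟩
  · intro h
    have h1 : Subgroup.closure {x} ≤ MulAction.stabilizer (R ≃ₐ[k] R) a := by
      rw [Subgroup.closure_le]
      rintro _ rfl
      exact h
    exact fun g => h1 g.2

theorem mem_invariants_sup {R : Type*} [Ring R] [Algebra k R] {G H : Subgroup (R ≃ₐ[k] R)} {a : R} :
    a ∈ invariants (G ⊔ H) ↔ a ∈ invariants G ∧ a ∈ invariants H := by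
  constructor
  · intro h
    exact ⟨fun g => h ⟨g, le_sup_left (a := G) g.2⟩, fun g => h ⟨g, le_sup_right (a := G) g.2⟩⟩
  · rintro ⟨h, h'⟩
    have h1 : G ⊔ H ≤ MulAction.stabilizer (R ≃ₐ[k] R) a :=
      sup_le (fun g hg => h ⟨g, hg⟩) fun g hg => h' ⟨g, hg⟩
    exact fun g => h1 g.2

theorem mem_classical {π : A →ₐ[k] k} {a : A} :
    a ∈ classical π ↔ a ∈ leftClassical π ∧ a ∈ rightClassical π :=
  mem_invariants_sup

/-! #### Antipode and invariants -/

/-- The antipode reverses `Δ`, so it exchanges left and right windings while inverting the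
character. -/
theorem leftWindingHom_antipode (f : A →ₐ[k] k) (a : A) :
    leftWindingHom f (antipode k a) = antipode k (rightWindingHom (characterInv f) a) := by
  change TensorProduct.lid k A (TensorProduct.map f.toLinearMap LinearMap.id
    (comul (antipode k a))) = _
  rw [comul_antipode, rightWindingHom_apply _ (ℛ k a), ← (ℛ k a).eq]
  simp [map_sum, characterInv_apply]

theorem rightWindingHom_antipode (f : A →ₐ[k] k) (a : A) :
    rightWindingHom f (antipode k a) = antipode k (leftWindingHom (characterInv f) a) := by
  change TensorProduct.rid k A (TensorProduct.map LinearMap.id f.toLinearMap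
    (comul (antipode k a))) = _
  rw [comul_antipode, leftWindingHom_apply _ (ℛ k a), ← (ℛ k a).eq]
  simp [map_sum, characterInv_apply]

theorem antipode_mem_leftClassical {π : A →ₐ[k] k} {a : A} (ha : a ∈ rightClassical π) :
    antipode k a ∈ leftClassical π := by
  refine mem_invariants_closure.2 ?_
  have h1 : rightWinding π a = a := mem_invariants_closure.1 ha
  have h2 : rightWindingHom (characterInv π) a = a := (rightWinding π).symm_apply_eq.2 h1.symm
  exact (leftWindingHom_antipode π a).trans (congrArg _ h2)

theorem antipode_mem_rightClassical {π : A →ₐ[k] k} {a : A} (ha : a ∈ leftClassical π) :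
    antipode k a ∈ rightClassical π := by
  refine mem_invariants_closure.2 ?_
  have h1 : leftWinding π a = a := mem_invariants_closure.1 ha
  have h2 : leftWindingHom (characterInv π) a = a := (leftWinding π).symm_apply_eq.2 h1.symm
  exact (rightWindingHom_antipode π a).trans (congrArg _ h2)

/-! #### The gradings are strong -/

/-- A functional vanishing on the image of the joint evaluation would be a linear relation between
distinct characters. -/
theorem exists_apply_eq_of_injective {R ι : Type*} [Ring R] [Algebra k R] [Finite ι]
    {f : ι → R →ₐ[k] k} (hf : Function.Injective f) (c : ι → k) : ∃ a, ∀ i, f i a = c i := by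
  classical
  have := Fintype.ofFinite ι
  let F : R →ₗ[k] ι → k := LinearMap.pi fun i => (f i).toLinearMap
  suffices h : LinearMap.range F = ⊤ by
    obtain ⟨a, ha⟩ := LinearMap.range_eq_top.1 h c
    exact ⟨a, fun i => congrFun ha i⟩
  by_contra hn
  obtain ⟨φ, hφ, hle⟩ := Submodule.exists_le_ker_of_lt_top _ (lt_top_iff_ne_top.2 hn)
  have hind := (linearIndependent_monoidHom R k).comp (fun i => ((f i : R →+* k) : R →* k))
    fun i j hij => hf (AlgHom.ext fun a => DFunLike.congr_fun hij a)
  rw [Fintype.linearIndependent_iff] at hind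
  apply hφ
  have h0 : ∀ i, φ (Pi.single i 1) = 0 := by
    refine hind (fun i => φ (Pi.single i 1)) ?_
    ext a
    have h1 : φ (F a) = 0 := hle ⟨a, rfl⟩
    rw [← Finset.univ_sum_single (F a), map_sum] at h1
    rw [Finset.sum_apply, Pi.zero_apply, ← h1]
    refine Finset.sum_congr rfl fun i _ => ?_
    have h2 : (Pi.single i (F a i) : ι → k) = f i a • Pi.single i 1 := by
      rw [← Pi.single_smul, smul_eq_mul, mul_one]
      rfl
    rw [h2, map_smul, smul_eq_mul, mul_comm]
    rfl
  refine LinearMap.pi_ext' fun i => LinearMap.ext_ring ?_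
  exact h0 i

section Strong

variable {R : Type v} [Ring R] [Algebra k R] {G : Subgroup (R ≃ₐ[k] R)} [Finite G]

/-- Averaging the hypothesis against `χ⁻¹` projects the left factors to `A_χ`; taking the part of
degree one of the result projects the right factors to `A_{χ⁻¹}`. -/
theorem exists_sum_eq_one_of_left (hk : (Nat.card G : k) ≠ 0) {χ : G →* kˣ} (s : Finset (R × R))
    (l r : R × R → R)
    (h : ∀ g : G, ∑ i ∈ s, (g : R ≃ₐ[k] R) (l i) * r i = algebraMap k R (χ g)) :
    ∃ (s : Finset (R × R)) (p q : R × R → R), (∀ i, p i ∈ component G χ) ∧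
      (∀ i, q i ∈ component G χ⁻¹) ∧ ∑ i ∈ s, p i * q i = 1 := by
  refine ⟨s, fun i => isotypicProj G χ (l i), fun i => isotypicProj G χ⁻¹ (r i),
    fun i => isotypicProj_mem _ _, fun i => isotypicProj_mem _ _, ?_⟩
  have h1 : ∑ i ∈ s, isotypicProj G χ (l i) * r i = 1 := by
    have := Fintype.ofFinite G
    simp only [isotypicProj_apply, smul_mul_assoc, Finset.sum_mul]
    rw [← Finset.smul_sum, Finset.sum_comm]
    simp only [← Finset.smul_sum, h]
    simp only [Algebra.smul_def, ← map_mul, Units.inv_mul, map_one, Finset.sum_const,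
      Finset.card_univ, eq_natCast, mul_one]
    rw [← map_natCast (algebraMap k R), ← map_mul, ← Nat.card_eq_fintype_card,
      inv_mul_cancel₀ hk, map_one]
  have h2 := congrArg (isotypicProj G 1) h1
  rw [isotypicProj_of_mem hk (mem_component_one.2 (one_mem _)), map_sum] at h2
  rw [← h2]
  refine Finset.sum_congr rfl fun i _ => ?_
  rw [isotypicProj_mul_left (isotypicProj_mem _ _), Character.one_mul_self]

theorem exists_sum_eq_one_of_right (hk : (Nat.card G : k) ≠ 0) {χ : G →* kˣ} (s : Finset (R × R))
    (l r : R × R → R)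
    (h : ∀ g : G, ∑ i ∈ s, l i * (g : R ≃ₐ[k] R) (r i) = algebraMap k R (χ⁻¹ g : kˣ)) :
    ∃ (s : Finset (R × R)) (p q : R × R → R), (∀ i, p i ∈ component G χ) ∧
      (∀ i, q i ∈ component G χ⁻¹) ∧ ∑ i ∈ s, p i * q i = 1 := by
  refine ⟨s, fun i => isotypicProj G χ (l i), fun i => isotypicProj G χ⁻¹ (r i),
    fun i => isotypicProj_mem _ _, fun i => isotypicProj_mem _ _, ?_⟩
  have h1 : ∑ i ∈ s, l i * isotypicProj G χ⁻¹ (r i) = 1 := by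
    have := Fintype.ofFinite G
    simp only [isotypicProj_apply, mul_smul_comm, Finset.mul_sum]
    rw [← Finset.smul_sum, Finset.sum_comm]
    simp only [← Finset.smul_sum, h]
    simp only [Algebra.smul_def, ← map_mul, Units.inv_mul, map_one, Finset.sum_const,
      Finset.card_univ, eq_natCast, mul_one]
    rw [← map_natCast (algebraMap k R), ← map_mul, ← Nat.card_eq_fintype_card,
      inv_mul_cancel₀ hk, map_one]
  have h2 := congrArg (isotypicProj G 1) h1
  rw [isotypicProj_of_mem hk (mem_component_one.2 (one_mem _)), map_sum] at h2
  rw [← h2]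
  refine Finset.sum_congr rfl fun i _ => ?_
  rw [isotypicProj_mul_right (isotypicProj_mem _ _), Character.inv_inv_self,
    Character.one_mul_self]

end Strong

theorem exists_sum_eq_one_leftGroup {π : A →ₐ[k] k} [Finite (leftGroup π)]
    (hk : (Nat.card (leftGroup π) : k) ≠ 0) (χ : leftGroup π →* kˣ) :
    ∃ (s : Finset (A × A)) (p q : A × A → A), (∀ i, p i ∈ component (leftGroup π) χ) ∧
      (∀ i, q i ∈ component (leftGroup π) χ⁻¹) ∧ ∑ i ∈ s, p i * q i = 1 := by
  let f : leftGroup π → A →ₐ[k] k := fun g =>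
    (Bialgebra.counitAlgHom k A).comp ((g : A ≃ₐ[k] A) : A →ₐ[k] A)
  have hf : Function.Injective f := by
    intro g g' hgg
    ext a
    have h1 : ∀ g : leftGroup π, (1 : k) ⊗ₜ[k] (g : A ≃ₐ[k] A) a =
        (f g).toLinearMap.rTensor A (comul a) := by
      intro g
      rw [← rTensor_counit_comul, comul_of_mem_leftGroup g.2, ← LinearMap.rTensor_comp_apply]
      rfl
    have h2 := h1 g
    rw [hgg, ← h1 g'] at h2
    simpa using congrArg (TensorProduct.lid k A) h2
  obtain ⟨a, ha⟩ := exists_apply_eq_of_injective hf fun g => (χ g : k)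
  refine exists_sum_eq_one_of_left hk (ℛ k a).index (ℛ k a).left
    (fun i => antipode k ((ℛ k a).right i)) fun g => ?_
  rw [← ha]
  have h1 := mul_antipode_lTensor_comul_apply (R := k) ((g : A ≃ₐ[k] A) a)
  rw [comul_of_mem_leftGroup g.2, ← (ℛ k a).eq] at h1
  simpa [map_sum, f] using h1

theorem exists_sum_eq_one_rightGroup {π : A →ₐ[k] k} [Finite (rightGroup π)]
    (hk : (Nat.card (rightGroup π) : k) ≠ 0) (χ : rightGroup π →* kˣ) :
    ∃ (s : Finset (A × A)) (p q : A × A → A), (∀ i, p i ∈ component (rightGroup π) χ) ∧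
      (∀ i, q i ∈ component (rightGroup π) χ⁻¹) ∧ ∑ i ∈ s, p i * q i = 1 := by
  let f : rightGroup π → A →ₐ[k] k := fun g =>
    (Bialgebra.counitAlgHom k A).comp ((g : A ≃ₐ[k] A) : A →ₐ[k] A)
  have hf : Function.Injective f := by
    intro g g' hgg
    ext a
    have h1 : ∀ g : rightGroup π, (g : A ≃ₐ[k] A) a ⊗ₜ[k] (1 : k) =
        (f g).toLinearMap.lTensor A (comul a) := by
      intro g
      rw [← lTensor_counit_comul, comul_of_mem_rightGroup g.2, ← LinearMap.lTensor_comp_apply]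
      rfl
    have h2 := h1 g
    rw [hgg, ← h1 g'] at h2
    simpa using congrArg (TensorProduct.rid k A) h2
  -- The inverse character appears because `g` now acts on the second factor, in `∑ S(a₁) g(a₂) =
  -- ε(g a)`.
  obtain ⟨a, ha⟩ := exists_apply_eq_of_injective hf fun g => ((χ⁻¹ g : kˣ) : k)
  refine exists_sum_eq_one_of_right hk (ℛ k a).index (fun i => antipode k ((ℛ k a).left i))
    (ℛ k a).right fun g => ?_
  rw [← ha]
  have h1 := mul_antipode_rTensor_comul_apply (R := k) ((g : A ≃ₐ[k] A) a)
  rw [comul_of_mem_rightGroup g.2, ← (ℛ k a).eq] at h1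
  simpa [map_sum, f] using h1

theorem isStronglyGraded_leftGroup [Nontrivial A] {π : A →ₐ[k] k}
    (hk : (orderOf (toConv π) : k) ≠ 0)
    (hcomm : ∀ a ∈ leftClassical π, ∀ b ∈ leftClassical π, a * b = b * a)
    (hdom : ∀ a ∈ leftClassical π, ∀ b ∈ leftClassical π, a * b = 0 → a = 0 ∨ b = 0) :
    IsStronglyGraded (leftGroup π) := by
  rw [← card_leftGroup] at hk
  have : Finite (leftGroup π) := Nat.finite_of_card_ne_zero fun h => hk (by rw [h, Nat.cast_zero])
  exact ⟨inferInstance, this, mul_comm_of_closure_singleton _, hk, exists_sum_eq_one_leftGroup hk,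
    hcomm, hdom⟩

/-- Commutativity and the absence of zero divisors pass from `A₀ˡ` to `A₀ʳ` through the antipode, an
injective antimorphism of rings. -/
theorem isStronglyGraded_rightGroup [Nontrivial A] [IsNoetherianRing A] {π : A →ₐ[k] k}
    (hk : (orderOf (toConv π) : k) ≠ 0)
    (hcomm : ∀ a ∈ leftClassical π, ∀ b ∈ leftClassical π, a * b = b * a)
    (hdom : ∀ a ∈ leftClassical π, ∀ b ∈ leftClassical π, a * b = 0 → a = 0 ∨ b = 0) :
    IsStronglyGraded (rightGroup π) := by
  rw [← card_rightGroup] at hk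
  have : Finite (rightGroup π) := Nat.finite_of_card_ne_zero fun h => hk (by rw [h, Nat.cast_zero])
  have hS := antipode_injective (k := k) (A := A)
  refine ⟨inferInstance, this, mul_comm_of_closure_singleton _, hk, exists_sum_eq_one_rightGroup hk,
    fun a ha b hb => hS ?_, fun a ha b hb hab => ?_⟩
  · rw [antipode_mul_antidistrib, antipode_mul_antidistrib]
    exact hcomm _ (antipode_mem_leftClassical hb) _ (antipode_mem_leftClassical ha)
  · have h1 := congrArg (antipode k) hab
    rw [antipode_mul_antidistrib, map_zero] at h1
    refine (hdom _ (antipode_mem_leftClassical hb) _ (antipode_mem_leftClassical ha) h1).symm.imp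
      (fun h => hS (h.trans (map_zero _).symm)) fun h => hS (h.trans (map_zero _).symm)

end WindingGroups

/-! ### Pairs of commuting groups -/

section Pairs

/-- Multiplication `G × H → Γ` is a homomorphism onto `G ⊔ H`, injective exactly when the
intersection is trivial. -/
theorem inf_eq_bot_iff_card_sup {Γ : Type*} [Group Γ] {G H : Subgroup Γ} [Finite G] [Finite H]
    (hGH : ∀ g ∈ G, ∀ h ∈ H, g * h = h * g) (hcard : Nat.card G = Nat.card H) :
    G ⊓ H = ⊥ ↔ Nat.card (G ⊔ H : Subgroup Γ) = Nat.card G ^ 2 := by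
  have hcom : ∀ (g : G) (h : H), Commute (G.subtype g) (H.subtype h) :=
    fun g h => hGH g g.2 h h.2
  let f : G × H →* Γ := MonoidHom.noncommCoprod G.subtype H.subtype hcom
  have hr : f.range = G ⊔ H := by
    simp only [f]
    rw [MonoidHom.noncommCoprod_range, Subgroup.range_subtype, Subgroup.range_subtype]
  have hf : Function.Injective f ↔ G ⊓ H = ⊥ := by
    simp only [f]
    rw [MonoidHom.noncommCoprod_injective, Subgroup.range_subtype, Subgroup.range_subtype,
      disjoint_iff]
    exact ⟨fun h => h.2.2, fun h => ⟨Subtype.val_injective, Subtype.val_injective, h⟩⟩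
  have hc : Nat.card (G × H) = Nat.card G ^ 2 := by rw [Nat.card_prod, ← hcard, sq]
  rw [← hf, ← hr, ← hc]
  constructor
  · intro h
    exact (Nat.card_congr (MonoidHom.ofInjective h).toEquiv).symm
  · intro h
    have h1 : Function.Bijective f.rangeRestrict :=
      Nat.bijective_iff_surjective_and_card _ |>.2 ⟨MonoidHom.rangeRestrict_surjective _, h.symm⟩
    exact fun x y hxy => h1.1 (Subtype.ext hxy)

variable {k : Type u} {A : Type v} [Field k] [Ring A] [Algebra k A]

theorem eq_zero_of_sum_smul_automorphisms_eq_zero {R ι : Type*} [Ring R] [Algebra k R]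
    [NoZeroDivisors R] [Nontrivial R] (hc : ∀ a b : R, a * b = b * a) [Fintype ι]
    {f : ι → R ≃ₐ[k] R} (hf : Function.Injective f) {c : ι → k}
    (h : ∀ b, ∑ i, c i • f i b = 0) (i : ι) : c i = 0 := by
  obtain ⟨inst, rfl⟩ : ∃ c : CommRing R, c.toRing = ‹Ring R› :=
    ⟨{ ‹Ring R› with mul_comm := hc }, rfl⟩
  have : IsDomain R := NoZeroDivisors.to_isDomain R
  have hind := (linearIndependent_monoidHom R R).comp (fun i => ((f i : R →+* R) : R →* R))
    fun i j hij => hf (AlgEquiv.ext fun a => DFunLike.congr_fun hij a)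
  rw [Fintype.linearIndependent_iff] at hind
  have h1 := hind (fun i => algebraMap k R (c i)) (by
    ext b
    rw [Finset.sum_apply, Pi.zero_apply, ← h b]
    refine Finset.sum_congr rfl fun i _ => ?_
    exact (Algebra.smul_def (c i) (f i b)).symm) i
  exact (map_eq_zero _).1 h1

namespace IsStronglyGraded

variable [IsAlgClosed k] {G H : Subgroup (A ≃ₐ[k] A)} (hG : IsStronglyGraded G)
  (hH : IsStronglyGraded H) (hGH : ∀ g ∈ G, ∀ h ∈ H, g * h = h * g)

include hG hH hGH in
/-- Nonzero invariants of `H` on which `G` acts through a given character. -/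
theorem exists_mem_component_inter_invariants (hinf : G ⊓ H = ⊥) (χ : G →* kˣ) :
    ∃ x ∈ component G χ, x ∈ invariants H ∧ x ≠ 0 := by
  have := hG.finite
  have := Fintype.ofFinite G
  have := hH.noZeroDivisors
  have := hH.nontrivial_invariants
  have hHG : ∀ h ∈ H, ∀ g ∈ G, h * g = g * h := fun h hh g hg => (hGH g hg h hh).symm
  have hinj : Function.Injective (restrictInvariants H G hHG) := by
    rw [injective_iff_map_eq_one]
    intro g hg
    have hgm : (g : A ≃ₐ[k] A) ^ Nat.card G = 1 := by
      have : g ^ Nat.card G = 1 := pow_card_eq_one'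
      exact congrArg Subtype.val this
    have h1 : (g : A ≃ₐ[k] A) ∈ H := hH.mem_of_fixes_invariants (fun h hh => hHG h hh g g.2)
      Nat.card_pos hgm
      fun a ha => congrArg Subtype.val (DFunLike.congr_fun hg (⟨a, ha⟩ : invariants H))
    have h2 : (g : A ≃ₐ[k] A) ∈ G ⊓ H := ⟨g.2, h1⟩
    rw [hinf, Subgroup.mem_bot] at h2
    exact Subtype.ext h2
  have hcomm : ∀ h : H, ∀ b : A, (h : A ≃ₐ[k] A) (isotypicProj G χ b) =
      isotypicProj G χ ((h : A ≃ₐ[k] A) b) := fun h b =>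
    (isotypicProj_map (h : A ≃ₐ[k] A).toLinearMap
      (fun g a => DFunLike.congr_fun (hHG h h.2 g g.2) a) χ b).symm
  -- Otherwise `∑ χ(g)⁻¹ g` vanishes on the invariants of `H`, a linear relation between
  -- automorphisms that `hinj` shows to be distinct.
  by_contra! hn
  have h0 : ∀ b : invariants H, isotypicProj G χ (b : A) = 0 := fun b =>
    hn _ (isotypicProj_mem χ _) fun h => (hcomm h b).trans (congrArg _ (b.2 h))
  have h1 := eq_zero_of_sum_smul_automorphisms_eq_zero hH.mul_comm_invariants hinj
    (c := fun g => (((χ g)⁻¹ : kˣ) : k)) (fun b => by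
      have h2 := h0 b
      rw [isotypicProj_apply, smul_eq_zero_iff_right (inv_ne_zero hG.card_ne_zero)] at h2
      refine Subtype.ext ?_
      rw [AddSubmonoidClass.coe_finsetSum]
      exact h2) 1
  exact Units.ne_zero _ h1

variable (hdeg : HasPIDegree A (Nat.card G)) (hcard : Nat.card G = Nat.card H)

include hH hdeg hcard in
-- The center is invariant under `H` as well, and automorphisms of the invariants of `G` that fix
-- the center are of the form `κ_χ`.
theorem range_restrictInvariants_le :
    (restrictInvariants G H hGH).range ≤ hG.kappa.range := by
  rintro _ ⟨h, rfl⟩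
  refine hG.mem_range_kappa_of_fixes_center fun a ha => Subtype.ext ?_
  exact hH.center_le_invariants (hcard ▸ hdeg) ha h

include hH hdeg hcard in
theorem closure_union_kappaSet_eq :
    Subgroup.closure (((restrictInvariants G H hGH).range : Set _) ∪ kappaSet G) =
      hG.kappa.range := by
  rw [hG.kappaSet_eq, Subgroup.closure_union, Subgroup.closure_eq, Subgroup.closure_eq]
  exact sup_eq_right.2 (range_restrictInvariants_le hG hH hGH hdeg hcard)

theorem kappa_range_comm : ∀ σ ∈ hG.kappa.range, ∀ τ ∈ hG.kappa.range, σ * τ = τ * σ := by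
  rintro _ ⟨χ, rfl⟩ _ ⟨ψ, rfl⟩
  rw [← map_mul, ← map_mul, Character.mul_comm_self]

include hH hdeg hcard in
-- The group of all `κ_χ` has the order of `H`, so equality means that restriction is injective on
-- `H`; its kernel is `G ⊓ H`.
theorem inf_eq_bot_iff_range_eq :
    G ⊓ H = ⊥ ↔ (restrictInvariants G H hGH).range = hG.kappa.range := by
  have hle := range_restrictInvariants_le hG hH hGH hdeg hcard
  have := hG.finite
  have := hH.finite
  have := hG.finite_range_kappa
  have hk : Nat.card hG.kappa.range = Nat.card H := by
    rw [← hcard, ← card_characters hG.comm hG.card_ne_zero]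
    exact (Nat.card_congr (MonoidHom.ofInjective (hG.kappa_injective hdeg)).toEquiv).symm
  constructor
  · intro hinf
    have hinj : Function.Injective (restrictInvariants G H hGH) := by
      rw [injective_iff_map_eq_one]
      intro h hh
      have hhm : (h : A ≃ₐ[k] A) ^ Nat.card H = 1 := by
        have : h ^ Nat.card H = 1 := pow_card_eq_one'
        exact congrArg Subtype.val this
      have h1 : (h : A ≃ₐ[k] A) ∈ G := hG.mem_of_fixes_invariants (fun g hg => hGH g hg h h.2)
        Nat.card_pos hhm
        fun a ha => congrArg Subtype.val (DFunLike.congr_fun hh (⟨a, ha⟩ : invariants G))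
      have h2 : (h : A ≃ₐ[k] A) ∈ G ⊓ H := ⟨h1, h.2⟩
      rw [hinf, Subgroup.mem_bot] at h2
      exact Subtype.ext h2
    refine Subgroup.eq_of_le_of_card_ge hle ?_
    rw [hk]
    exact (Nat.card_congr (MonoidHom.ofInjective hinj).toEquiv).le
  · intro heq
    have hsurj : Function.Bijective (restrictInvariants G H hGH).rangeRestrict := by
      rw [Nat.bijective_iff_surjective_and_card]
      exact ⟨MonoidHom.rangeRestrict_surjective _, by rw [heq, hk]⟩
    rw [eq_bot_iff]
    rintro h ⟨h1, h2⟩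
    have h3 : (⟨h, h2⟩ : H) = 1 := by
      refine hsurj.1 (Subtype.ext ?_)
      rw [map_one]
      ext a
      exact a.2 ⟨h, h1⟩
    exact congrArg Subtype.val h3

include hH hdeg hcard in
-- Inside the invariants of `G` the two rings are the fixed rings of the two finite groups, which
-- determine the groups.
theorem range_eq_iff_center_eq :
    (restrictInvariants G H hGH).range = hG.kappa.range ↔
      Subalgebra.center k A = invariants (G ⊔ H) := by
  have hle := range_restrictInvariants_le hG hH hGH hdeg hcard
  have := hH.finite
  constructor
  · intro heq
    refine le_antisymm (fun z hz => ?_) fun a ha => ?_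
    · exact mem_invariants_sup.2
        ⟨hG.center_le_invariants hdeg hz, hH.center_le_invariants (hcard ▸ hdeg) hz⟩
    · obtain ⟨ha1, ha2⟩ := mem_invariants_sup.1 ha
      refine (hG.mem_center_iff ⟨a, ha1⟩).2 fun χ => ?_
      obtain ⟨h, hh⟩ : hG.kappa χ ∈ (restrictInvariants G H hGH).range := heq ▸ ⟨χ, rfl⟩
      rw [← hh]
      exact Subtype.ext (ha2 h)
  · intro heq
    refine le_antisymm hle ?_
    rintro _ ⟨χ, rfl⟩
    have : Finite (restrictInvariants G H hGH).range := Set.finite_range _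
    refine hG.mem_subgroup_of_fixes _ _ fun a ha => ?_
    refine (hG.mem_center_iff a).1 ?_ χ
    rw [heq]
    exact mem_invariants_sup.2 ⟨a.2, fun h => congrArg Subtype.val (ha _ ⟨h, rfl⟩)⟩

end IsStronglyGraded

end Pairs

/-! ### The coproduct of the classical component -/

section Classical

open Coalgebra HopfAlgebra

variable {k : Type u} {A : Type v} [Field k] [Ring A] [HopfAlgebra k A]

theorem rTensor_isotypicProj {R : Type*} [AddCommGroup R] [Module k R] {G : Subgroup (A ≃ₐ[k] A)}
    [Fintype G] (χ : G →* kˣ) (t : A ⊗[k] R) :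
    (isotypicProj G χ).rTensor R t = (Nat.card G : k)⁻¹ •
      ∑ g : G, ((χ g)⁻¹ : kˣ).1 • (g : A ≃ₐ[k] A).toLinearMap.rTensor R t := by
  induction t with
  | zero => simp
  | add x y hx hy => simp only [map_add, hx, hy, smul_add, Finset.sum_add_distrib]
  | tmul x y =>
    simp only [LinearMap.rTensor_tmul, isotypicProj_apply, ← TensorProduct.smul_tmul',
      TensorProduct.sum_tmul, AlgEquiv.toLinearMap_apply]

theorem lTensor_isotypicProj {R : Type*} [AddCommGroup R] [Module k R] {G : Subgroup (A ≃ₐ[k] A)}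
    [Fintype G] (χ : G →* kˣ) (t : R ⊗[k] A) :
    (isotypicProj G χ).lTensor R t = (Nat.card G : k)⁻¹ •
      ∑ g : G, ((χ g)⁻¹ : kˣ).1 • (g : A ≃ₐ[k] A).toLinearMap.lTensor R t := by
  induction t with
  | zero => simp
  | add x y hx hy => simp only [map_add, hx, hy, smul_add, Finset.sum_add_distrib]
  | tmul x y => simp [isotypicProj_apply, TensorProduct.tmul_sum]

theorem comul_isotypicProj_leftGroup {π : A →ₐ[k] k} [Finite (leftGroup π)]
    (χ : leftGroup π →* kˣ) (a : A) :
    comul (isotypicProj (leftGroup π) χ a) =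
      (isotypicProj (leftGroup π) χ).rTensor A (comul (R := k) a) := by
  have := Fintype.ofFinite (leftGroup π)
  rw [rTensor_isotypicProj, isotypicProj_apply, map_smul, map_sum]
  congr 1
  exact Finset.sum_congr rfl fun g _ => by rw [map_smul, comul_of_mem_leftGroup g.2]

theorem comul_isotypicProj_rightGroup {π : A →ₐ[k] k} [Finite (rightGroup π)]
    (χ : rightGroup π →* kˣ) (a : A) :
    comul (isotypicProj (rightGroup π) χ a) =
      (isotypicProj (rightGroup π) χ).lTensor A (comul (R := k) a) := by
  have := Fintype.ofFinite (rightGroup π)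
  rw [lTensor_isotypicProj, isotypicProj_apply, map_smul, map_sum]
  congr 1
  exact Finset.sum_congr rfl fun g _ => by rw [map_smul, comul_of_mem_rightGroup g.2]

theorem rTensor_isotypicProj_one_of_fixed {R : Type*} [AddCommGroup R] [Module k R]
    {G : Subgroup (A ≃ₐ[k] A)} [Finite G] (hk : (Nat.card G : k) ≠ 0) {t : A ⊗[k] R}
    (ht : ∀ g ∈ G, g.toLinearMap.rTensor R t = t) : (isotypicProj G 1).rTensor R t = t := by
  have := Fintype.ofFinite G
  rw [rTensor_isotypicProj, Finset.sum_congr rfl fun g _ => by rw [ht g g.2]]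
  simp only [MonoidHom.one_apply, inv_one, Units.val_one, one_smul, Finset.sum_const,
    Finset.card_univ]
  rw [← Nat.cast_smul_eq_nsmul k, smul_smul, ← Nat.card_eq_fintype_card, inv_mul_cancel₀ hk,
    one_smul]

theorem lTensor_isotypicProj_one_of_fixed {R : Type*} [AddCommGroup R] [Module k R]
    {G : Subgroup (A ≃ₐ[k] A)} [Finite G] (hk : (Nat.card G : k) ≠ 0) {t : R ⊗[k] A}
    (ht : ∀ g ∈ G, g.toLinearMap.lTensor R t = t) : (isotypicProj G 1).lTensor R t = t := by
  have := Fintype.ofFinite G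
  rw [lTensor_isotypicProj, Finset.sum_congr rfl fun g _ => by rw [ht g g.2]]
  simp only [MonoidHom.one_apply, inv_one, Units.val_one, one_smul, Finset.sum_const,
    Finset.card_univ]
  rw [← Nat.cast_smul_eq_nsmul k, smul_smul, ← Nat.card_eq_fintype_card, inv_mul_cancel₀ hk,
    one_smul]

/-- Left windings pass through `Δ` to the first factor and right windings to the second, so `Δ(x)`
lies in `Aˡ_χ ⊗ A₀ʳ`. -/
theorem comul_eq_map_isotypicProj {π : A →ₐ[k] k} [Finite (leftGroup π)] [Finite (rightGroup π)]
    (hl : (Nat.card (leftGroup π) : k) ≠ 0) (hr : (Nat.card (rightGroup π) : k) ≠ 0)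
    {χ : leftGroup π →* kˣ} {x : A} (hx : x ∈ component (leftGroup π) χ)
    (hx' : x ∈ rightClassical π) :
    comul (R := k) x = TensorProduct.map (isotypicProj (leftGroup π) χ)
      (isotypicProj (rightGroup π) 1) (comul x) := by
  rw [← LinearMap.lTensor_comp_rTensor, LinearMap.comp_apply, ← comul_isotypicProj_leftGroup,
    isotypicProj_of_mem hl hx, ← comul_isotypicProj_rightGroup,
    isotypicProj_of_mem hr (mem_component_one.2 hx')]

theorem comulPreimage_le (B : Subalgebra k A) : comulPreimage B ≤ B.toSubmodule := by
  rintro a ⟨t, ht⟩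
  have h1 : ∀ t : B ⊗[k] B, TensorProduct.lid k A ((counit (R := k) (A := A)).rTensor A
      (TensorProduct.map B.val.toLinearMap B.val.toLinearMap t)) ∈ B.toSubmodule := by
    intro t
    induction t with
    | zero => simp
    | add x y hx hy => simp only [map_add]; exact add_mem hx hy
    | tmul x y =>
      simp only [TensorProduct.map_tmul, LinearMap.rTensor_tmul, TensorProduct.lid_tmul]
      exact B.toSubmodule.smul_mem _ y.2
  have h2 := h1 t
  rw [ht, rTensor_counit_comul, TensorProduct.lid_tmul, one_smul] at h2
  exact h2

variable [IsAlgClosed k] {π : A →ₐ[k] k}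

theorem rTensor_comul_eq_of_mem_center (hl : IsStronglyGraded (leftGroup π))
    (hr : IsStronglyGraded (rightGroup π)) (hinf : leftGroup π ⊓ rightGroup π = ⊥)
    (hrange : (rhoLeft π).range = hl.kappa.range) {a : A} (ha : a ∈ classical π)
    (hac : a ∈ Subalgebra.center k A) {g : A ≃ₐ[k] A} (hg : g ∈ rightGroup π) :
    g.toLinearMap.rTensor A (comul (R := k) a) = comul a := by
  have := hl.finite
  have := hr.finite
  obtain ⟨χ, hχ⟩ : rhoLeft π ⟨g, hg⟩ ∈ hl.kappa.range := hrange ▸ ⟨_, rfl⟩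
  obtain ⟨x, hx, hx', hx0⟩ := hl.exists_mem_component_inter_invariants hr
    (leftGroup_commute_rightGroup π) hinf χ
  obtain ⟨ha1, ha2⟩ := mem_classical.1 ha
  -- In the first factor, moving an invariant past `Aˡ_χ` applies `κ_χ = ρˡ(g)`; in the second, both
  -- elements lie in the commutative ring `A₀ʳ`.
  have key : ∀ s t : A ⊗[k] A,
      TensorProduct.map (isotypicProj (leftGroup π) χ) (isotypicProj (rightGroup π) 1) s *
        TensorProduct.map (isotypicProj (leftGroup π) 1) (isotypicProj (rightGroup π) 1) t =
      g.toLinearMap.rTensor A (TensorProduct.map (isotypicProj (leftGroup π) 1)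
        (isotypicProj (rightGroup π) 1) t) *
        TensorProduct.map (isotypicProj (leftGroup π) χ) (isotypicProj (rightGroup π) 1) s := by
    intro s t
    induction s with
    | zero => simp
    | add s s' hs hs' => simp only [map_add, add_mul, mul_add, hs, hs']
    | tmul p q =>
      induction t with
      | zero => simp
      | add t t' ht ht' => simp only [map_add, add_mul, mul_add, ht, ht']
      | tmul b c =>
        simp only [TensorProduct.map_tmul, Algebra.TensorProduct.tmul_mul_tmul,
          LinearMap.rTensor_tmul]
        have hb := mem_component_one.1 (isotypicProj_mem (G := leftGroup π) 1 b)
        have hq := mem_component_one.1 (isotypicProj_mem (G := rightGroup π) 1 q)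
        have hc := mem_component_one.1 (isotypicProj_mem (G := rightGroup π) 1 c)
        have e1 := hl.isKappa_kappa χ _ (isotypicProj_mem χ p) ⟨_, hb⟩
        rw [hχ] at e1
        rw [hr.mul_comm _ hq _ hc]
        exact congrArg (· ⊗ₜ[k] _) e1
  have h1 := key (comul x) (comul a)
  rw [← comul_eq_map_isotypicProj hl.card_ne_zero hr.card_ne_zero hx hx',
    ← comul_eq_map_isotypicProj hl.card_ne_zero hr.card_ne_zero (mem_component_one.2 ha1) ha2,
    ← Bialgebra.comul_mul, Subalgebra.mem_center_iff.1 hac x, Bialgebra.comul_mul] at h1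
  refine sub_eq_zero.1 (eq_zero_of_mul_comul_eq_zero (x := x)
    (fun y hy => hl.eq_zero_of_mul_eq_zero hx hx0 hy) ?_)
  rw [sub_mul, h1, sub_self]

/-- Left invariance in the first factor and right invariance in the second come from `a ∈ A₀`, the
other two from centrality. Averaging over both groups in both factors therefore fixes `Δ(a)`. -/
theorem mem_comulPreimage_classical (hl : IsStronglyGraded (leftGroup π))
    (hr : IsStronglyGraded (rightGroup π)) (hinf : leftGroup π ⊓ rightGroup π = ⊥)
    (hrange : (rhoLeft π).range = hl.kappa.range) {a : A} (ha : a ∈ classical π)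
    (hac : a ∈ Subalgebra.center k A) : a ∈ comulPreimage (classical π) := by
  have := hl.finite
  have := hr.finite
  obtain ⟨ha1, ha2⟩ := mem_classical.1 ha
  have hR : ∀ g ∈ rightGroup π, g.toLinearMap.rTensor A (comul (R := k) a) = comul a :=
    fun g hg => rTensor_comul_eq_of_mem_center hl hr hinf hrange ha hac hg
  have hL : ∀ g ∈ leftGroup π, g.toLinearMap.lTensor A (comul (R := k) a) = comul a := by
    intro g hg
    induction hg using Subgroup.closure_induction with
    | mem g hg =>
      rw [Set.mem_singleton_iff.1 hg, ← rTensor_rightWinding_comul]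
      exact hR _ (Subgroup.subset_closure rfl)
    | one => exact LinearMap.lTensor_id_apply A A (comul a)
    | mul g f _ _ hg hf =>
      have : (g * f).toLinearMap = g.toLinearMap ∘ₗ f.toLinearMap := rfl
      rw [this, LinearMap.lTensor_comp_apply, hf, hg]
    | inv g _ hg =>
      have h2 : (g⁻¹).toLinearMap ∘ₗ g.toLinearMap = (LinearMap.id : A →ₗ[k] A) := by
        ext x
        exact DFunLike.congr_fun (inv_mul_cancel g) x
      conv_lhs => rw [← hg]
      rw [← LinearMap.lTensor_comp_apply, h2, LinearMap.lTensor_id_apply]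
  have hcommute : ∀ b, isotypicProj (leftGroup π) 1 (isotypicProj (rightGroup π) 1 b) =
      isotypicProj (rightGroup π) 1 (isotypicProj (leftGroup π) 1 b) := fun b => by
    refine (isotypicProj_map (isotypicProj (leftGroup π) 1) (fun g c => ?_) 1 b).symm
    exact isotypicProj_map (g : A ≃ₐ[k] A).toLinearMap (fun f d => (DFunLike.congr_fun
      (leftGroup_commute_rightGroup π f f.2 g g.2) d).symm) 1 c
  let E : A →ₗ[k] A := isotypicProj (leftGroup π) 1 ∘ₗ isotypicProj (rightGroup π) 1
  have hE : ∀ b, E b ∈ (classical π).toSubmodule := by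
    intro b
    refine mem_classical.2 ⟨mem_component_one.1 (isotypicProj_mem _ _), ?_⟩
    change isotypicProj (leftGroup π) 1 (isotypicProj (rightGroup π) 1 b) ∈ _
    rw [hcommute]
    exact mem_component_one.1 (isotypicProj_mem _ _)
  let E' : A →ₗ[k] classical π := E.codRestrict (classical π).toSubmodule hE
  have hEE : TensorProduct.map E E (comul (R := k) a) = comul a := by
    rw [← LinearMap.lTensor_comp_rTensor, LinearMap.comp_apply]
    have e1 : E.rTensor A (comul (R := k) a) = comul a := by
      rw [LinearMap.rTensor_comp_apply, rTensor_isotypicProj_one_of_fixed hr.card_ne_zero hR,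
        ← comul_isotypicProj_leftGroup, isotypicProj_of_mem hl.card_ne_zero
          (mem_component_one.2 ha1)]
    rw [e1, LinearMap.lTensor_comp_apply, ← comul_isotypicProj_rightGroup,
      isotypicProj_of_mem hr.card_ne_zero (mem_component_one.2 ha2),
      lTensor_isotypicProj_one_of_fixed hl.card_ne_zero hL]
  refine ⟨TensorProduct.map E' E' (comul a), ?_⟩
  rw [← LinearMap.comp_apply, ← TensorProduct.map_comp]
  exact hEE

end Classical

end

/-! ### The main theorem. -/

theorem theorem5p2 {k : Type u} {A : Type v} [Field k] [IsAlgClosed k] [Ring A] [HopfAlgebra k A]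
    (hAffine : Algebra.FiniteType k A) (hNoeth : IsTwoSidedNoetherian A)
    (hPrime : IsPrimeRing A) (hPI : IsPIAlgebra k A)
    (π : A →ₐ[k] k) (n : ℕ)
    (hOrder : orderOf (WithConv.toConv π) = n) (hDeg : HasPIDegree A n)
    (hDedekind : IsCommDedekindDomain (leftClassical π))
    (hChar : 0 < ringChar k → Nat.Coprime n (ringChar k)) :
    -- the center lies in the classical component
    Subalgebra.center k A ≤ classical π ∧
    -- the automorphisms `κ_χ` on both sides are well defined
    (∀ χ : leftGroup π →* kˣ, ∃! σ, IsKappa (leftGroup π) χ σ) ∧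
    (∀ χ : rightGroup π →* kˣ, ∃! σ, IsKappa (rightGroup π) χ σ) ∧
    -- `Pˡ` is abelian and equals `Kˡ`
    (∀ σ ∈ pLeft π, ∀ τ ∈ pLeft π, σ * τ = τ * σ) ∧
    (pLeft π : Set _) = kappaSet (leftGroup π) ∧
    -- the equivalent conditions
    List.TFAE
      [leftGroup π ⊓ rightGroup π = ⊥,
       Nat.card (windingGroup π) = n ^ 2,
       ((rhoLeft π).range : Set _) = kappaSet (leftGroup π) ∧
         kappaSet (leftGroup π) = (pLeft π : Set _),
       Subalgebra.center k A = classical π,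
       ((rhoRight π).range : Set _) = kappaSet (rightGroup π) ∧
         kappaSet (rightGroup π) = (pRight π : Set _)] ∧
    -- under these conditions `A₀ = Z(A)` is a Hopf subalgebra
    (leftGroup π ⊓ rightGroup π = ⊥ →
      (classical π).toSubmodule = comulPreimage (classical π) ∧
      classical π = Subalgebra.center k A ∧
      IsHopfSubalgebra (classical π)) := by
  have : Nontrivial A := hPrime.1
  have : IsNoetherianRing A := hNoeth.1
  -- PI-degree zero would embed `A` in the zero ring of empty matrices.
  have hn : n ≠ 0 := by
    rintro rfl
    obtain ⟨C, _, f, hf⟩ := hDeg.1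
    exact not_subsingleton A (hf.subsingleton)
  have hk : (orderOf (WithConv.toConv π) : k) ≠ 0 := by
    rw [hOrder]
    intro h0
    have hdvd := (ringChar.spec k n).1 h0
    rcases Nat.eq_zero_or_pos (ringChar k) with hp | hp
    · rw [hp, zero_dvd_iff] at hdvd
      exact hn hdvd
    · have := Nat.eq_one_of_dvd_coprimes (hChar hp) hdvd dvd_rfl
      exact CharP.ringChar_ne_one this
  obtain ⟨hcomm, hD⟩ := hDedekind
  have hcomm' : ∀ a ∈ leftClassical π, ∀ b ∈ leftClassical π, a * b = b * a := fun a ha b hb =>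
    congrArg Subtype.val (hcomm ⟨a, ha⟩ ⟨b, hb⟩)
  have hdom' : ∀ a ∈ leftClassical π, ∀ b ∈ leftClassical π, a * b = 0 → a = 0 ∨ b = 0 := by
    intro a ha b hb hab
    let _ : CommRing (leftClassical π) :=
      { (inferInstance : Ring (leftClassical π)) with mul_comm := hcomm }
    have hdom : IsDomain (leftClassical π) := hD.1
    have h1 : (⟨a, ha⟩ : leftClassical π) * ⟨b, hb⟩ = 0 := Subtype.ext hab
    exact (mul_eq_zero.1 h1).imp (congrArg Subtype.val) (congrArg Subtype.val)
  have hl := isStronglyGraded_leftGroup hk hcomm' hdom'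
  have hr := isStronglyGraded_rightGroup hk hcomm' hdom'
  have hcl : Nat.card (leftGroup π) = n := (card_leftGroup π).trans hOrder
  have hcr : Nat.card (rightGroup π) = n := (card_rightGroup π).trans hOrder
  have hdl : HasPIDegree A (Nat.card (leftGroup π)) := hcl.symm ▸ hDeg
  have hdr : HasPIDegree A (Nat.card (rightGroup π)) := hcr.symm ▸ hDeg
  have hlr := leftGroup_commute_rightGroup π
  have hrl : ∀ g ∈ rightGroup π, ∀ h ∈ leftGroup π, g * h = h * g :=
    fun g hg h hh => (hlr h hh g hg).symm
  have hPl : pLeft π = hl.kappa.range :=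
    hl.closure_union_kappaSet_eq hr hlr hdl (hcl.trans hcr.symm)
  have hPr : pRight π = hr.kappa.range :=
    hr.closure_union_kappaSet_eq hl hrl hdr (hcr.trans hcl.symm)
  have h13 : leftGroup π ⊓ rightGroup π = ⊥ ↔ (rhoLeft π).range = hl.kappa.range :=
    hl.inf_eq_bot_iff_range_eq hr hlr hdl (hcl.trans hcr.symm)
  have h15 : rightGroup π ⊓ leftGroup π = ⊥ ↔ (rhoRight π).range = hr.kappa.range :=
    hr.inf_eq_bot_iff_range_eq hl hrl hdr (hcr.trans hcl.symm)
  have h34 : (rhoLeft π).range = hl.kappa.range ↔ Subalgebra.center k A = classical π :=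
    hl.range_eq_iff_center_eq hr hlr hdl (hcl.trans hcr.symm)
  refine ⟨fun z hz => mem_classical.2 ⟨hl.center_le_invariants hdl hz,
    hr.center_le_invariants hdr hz⟩, hl.existsUnique_isKappa, hr.existsUnique_isKappa, ?_, ?_, ?_,
    fun hinf => ?_⟩
  · rw [hPl]
    exact hl.kappa_range_comm
  · rw [hPl, hl.kappaSet_eq]
  · tfae_have 1 ↔ 2 := by
      have := hl.finite
      have := hr.finite
      rw [inf_eq_bot_iff_card_sup hlr (hcl.trans hcr.symm), hcl]
      rfl
    tfae_have 1 ↔ 3 := by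
      rw [h13, hPl, hl.kappaSet_eq, SetLike.coe_set_eq]
      exact ⟨fun h => ⟨h, rfl⟩, fun h => h.1⟩
    tfae_have 1 ↔ 4 := h13.trans h34
    tfae_have 1 ↔ 5 := by
      rw [inf_comm, h15, hPr, hr.kappaSet_eq, SetLike.coe_set_eq]
      exact ⟨fun h => ⟨h, rfl⟩, fun h => h.1⟩
    tfae_finish
  · have hrange := h13.1 hinf
    have hcenter := h34.1 hrange
    have hmem : ∀ a ∈ classical π, a ∈ comulPreimage (classical π) := fun a ha =>
      mem_comulPreimage_classical hl hr hinf hrange ha (hcenter ▸ ha)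
    refine ⟨le_antisymm hmem (comulPreimage_le _), hcenter.symm, hmem, fun a ha => ?_⟩
    obtain ⟨ha1, ha2⟩ := mem_classical.1 ha
    exact mem_classical.2 ⟨antipode_mem_leftClassical ha2, antipode_mem_rightClassical ha1⟩
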